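/- Let $G=(A\cup B,E)$ be a finite bipartite graph with given bipartition $A\cup B$. A Stick representation of $G$ assigns to every $a\in A$ a horizontal segment and to every $b\in B$ a vertical segment in the plane (closed, of positive length) such that the left end-points of all horizontal segments and the bottom end-points of all vertical segments lie on a common ground line of slope $-1$, and such that two distinct vertices of $G$ are adjacent if and only if their segments intersect. The fixed-$A$ Stick problem is: given $G$ (by its $|A|\times|B|$ bipartite adjacency matrix) and an ordering $\sigma_A$ of $A$, does $G$ have a Stick representation in which, from left to right along the ground line, the $i$th horizontal segment is that of the $i$th vertex of $\sigma_A$? Theorem. There is an algorithm that solves the fixed-$A$ Stick problem and that outputs such a representation (the coordinates of the ground line and of all segments) whenever one exists; for $A$ and $B$ non-empty its running time is $O(|A|^3|B|^3)$. Running time is the number of elementary steps on a unit-cost random access machine with addition and subtraction. -/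

import Mathlib

/-! ### Stick representations -/

/-- A family of axis-aligned segments in the plane, a horizontal one for every `a : A` and a
vertical one for every `b : B`, grounded on the line `x + y = ground` of slope `-1`. -/
structure StickDrawing (A B : Type*) where
  /-- the ground line is `x + y = ground` -/
  ground : ℝ
  /-- the `x`-coordinate at which the horizontal segment of `a` touches the ground line -/
  hfoot : A → ℝ
  /-- the `x`-coordinate of the right end-point of the horizontal segment of `a` -/
  hend : A → ℝ
  /-- the `x`-coordinate at which the vertical segment of `b` touches the ground line -/
  vfoot : B → ℝ
  /-- the `y`-coordinate of the top end-point of the vertical segment of `b` -/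
  vend : B → ℝ

namespace StickDrawing

variable {A B : Type*}

/-- The (closed) segment that the drawing assigns to a vertex. -/
def seg (D : StickDrawing A B) : A ⊕ B → Set (ℝ × ℝ)
  | Sum.inl a => segment ℝ (D.hfoot a, D.ground - D.hfoot a) (D.hend a, D.ground - D.hfoot a)
  | Sum.inr b => segment ℝ (D.vfoot b, D.ground - D.vfoot b) (D.vfoot b, D.vend b)

/-- `D` is a Stick representation of `G`: the foot of every horizontal segment is its left
end-point, the foot of every vertical segment is its bottom end-point, and `G` is the
intersection graph of the segments. -/
def Represents (D : StickDrawing A B) (G : SimpleGraph (A ⊕ B)) : Prop :=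
  (∀ a, D.hfoot a < D.hend a) ∧
  (∀ b, D.ground - D.vfoot b < D.vend b) ∧
  ∀ u v, u ≠ v → (G.Adj u v ↔ (D.seg u ∩ D.seg v).Nonempty)

end StickDrawing

/-- `D` respects the vertex ordering `σ 0, σ 1, …, σ (n - 1)` of `A`: from left to right along the
ground line, the `i`-th horizontal segment is that of `σ i`. -/
def StickDrawing.RespectsA {n : ℕ} {B : Type*} (D : StickDrawing (Fin n) B)
    (σ : Equiv.Perm (Fin n)) : Prop :=
  StrictMono fun i => D.hfoot (σ i)

/-! ### A unit-cost random access machine -/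

/-- Memory of the machine: registers and (one-dimensional) arrays, holding natural numbers. -/
structure RamState where
  reg : ℕ → ℕ
  arr : ℕ → ℕ → ℕ

namespace RamState

/-- Write `v` into register `x`. -/
def setReg (s : RamState) (x v : ℕ) : RamState :=
  { s with reg := Function.update s.reg x v }

/-- Write `v` into cell `i` of array `k`. -/
def setArr (s : RamState) (k i v : ℕ) : RamState :=
  { s with arr := Function.update s.arr k (Function.update (s.arr k) i v) }

end RamState

/-- Comparisons of two registers. -/
inductive RamTest
  | lt (x y : ℕ)
  | eq (x y : ℕ)

/-- Truth of a comparison in a memory state. -/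
def RamTest.holds : RamTest → RamState → Prop
  | .lt x y, s => s.reg x < s.reg y
  | .eq x y, s => s.reg x = s.reg y

/-- Programs of the machine. The variables `x`, `y`, `z` are register names, `k` is the name of an
array, `c` is a constant; all of them are fixed in the program text. -/
inductive RamProgram
  /-- do nothing -/
  | skip
  /-- `x := c` -/
  | const (x c : ℕ)
  /-- `x := y` -/
  | copy (x y : ℕ)
  /-- `x := y + z` -/
  | add (x y z : ℕ)
  /-- `x := y - z`, or `0` if `y < z` -/
  | sub (x y z : ℕ)
  /-- `x := k[y]` -/
  | load (x k y : ℕ)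
  /-- `k[x] := y` -/
  | store (k x y : ℕ)
  /-- first `p`, then `q` -/
  | seq (p q : RamProgram)
  /-- `if b then p else q` -/
  | ite (b : RamTest) (p q : RamProgram)
  /-- `while b do p` -/
  | loop (b : RamTest) (p : RamProgram)

/-- `RamExec p s t s'`: started in the memory state `s`, the program `p` halts after exactly `t`
elementary steps, in the memory state `s'`. Every elementary instruction and every evaluation of a
comparison is one step. -/
inductive RamExec : RamProgram → RamState → ℕ → RamState → Prop
  | skip (s : RamState) : RamExec .skip s 1 s
  | const (x c : ℕ) (s : RamState) : RamExec (.const x c) s 1 (s.setReg x c)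
  | copy (x y : ℕ) (s : RamState) : RamExec (.copy x y) s 1 (s.setReg x (s.reg y))
  | add (x y z : ℕ) (s : RamState) :
      RamExec (.add x y z) s 1 (s.setReg x (s.reg y + s.reg z))
  | sub (x y z : ℕ) (s : RamState) :
      RamExec (.sub x y z) s 1 (s.setReg x (s.reg y - s.reg z))
  | load (x k y : ℕ) (s : RamState) :
      RamExec (.load x k y) s 1 (s.setReg x (s.arr k (s.reg y)))
  | store (k x y : ℕ) (s : RamState) :
      RamExec (.store k x y) s 1 (s.setArr k (s.reg x) (s.reg y))
  | seq {p q : RamProgram} {s s' s'' : RamState} {t t' : ℕ} :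
      RamExec p s t s' → RamExec q s' t' s'' → RamExec (.seq p q) s (t + t') s''
  | ite_true {b : RamTest} {p q : RamProgram} {s s' : RamState} {t : ℕ} :
      b.holds s → RamExec p s t s' → RamExec (.ite b p q) s (t + 1) s'
  | ite_false {b : RamTest} {p q : RamProgram} {s s' : RamState} {t : ℕ} :
      ¬ b.holds s → RamExec q s t s' → RamExec (.ite b p q) s (t + 1) s'
  | loop_done {b : RamTest} {p : RamProgram} {s : RamState} :
      ¬ b.holds s → RamExec (.loop b p) s 1 s
  | loop_step {b : RamTest} {p : RamProgram} {s s' s'' : RamState} {t t' : ℕ} :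
      b.holds s → RamExec p s t s' → RamExec (.loop b p) s' t' s'' →
      RamExec (.loop b p) s (t + t' + 1) s''

/-! ### Input and output conventions -/

open Classical in
/-- The initial memory for the graph `G` with vertex ordering `σ` of `A = Fin n`: registers `0` and
`1` hold `n` and `m`, array `0` holds the `n × m` bipartite adjacency matrix row by row (entry
`(a, b)` in cell `a * m + b`), array `1` holds the list `σ 0, …, σ (n - 1)`; everything else
is `0`. -/
noncomputable def fixedAInput {n m : ℕ} (G : SimpleGraph (Fin n ⊕ Fin m))
    (σ : Equiv.Perm (Fin n)) : RamState where
  reg x := if x = 0 then n else if x = 1 then m else 0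
  arr k c :=
    if k = 0 then
      if ∃ (a : Fin n) (b : Fin m), c = a * m + b ∧ G.Adj (Sum.inl a) (Sum.inr b) then 1 else 0
    else if k = 1 then
      if h : c < n then (σ ⟨c, h⟩ : ℕ) else 0
    else 0

/-- The drawing written in memory: register `1` holds the constant of the ground line, arrays `0`
and `1` hold the feet and right ends of the horizontal segments, arrays `2` and `3` hold the feet
and tops of the vertical segments. (Register `0` holds the yes/no answer.) -/
def RamState.drawing (n m : ℕ) (s : RamState) : StickDrawing (Fin n) (Fin m) where
  ground := s.reg 1
  hfoot a := s.arr 0 a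
  hend a := s.arr 1 a
  vfoot b := s.arr 2 b
  vend b := s.arr 3 b

/-! ### Geometry of grounded segments -/

/-! On the ground line, height falls from left to right. So a horizontal `a` and a vertical `b` meet
exactly when the foot of `a` is not to the right of the foot of `b`, `a` extends to `b`, and `b`
extends up to the height of `a`. With the order of `A` fixed, a vertical segment may be cut at the
height of its first neighbour. What remains unknown is the place `v b` of each vertical and the
right end `e i` of each horizontal, and `b` meets the `i`-th horizontal iff `F b ≤ level m i < v b ≤
e i`.

A representation thus amounts to labels for which `v b` lies beyond the last neighbour of `b`, `v b
≤ e i` holds at every edge, and `e i < v b` holds at every non-edge with `F b ≤ level m i < v b`.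
`represents_of_stable` turns such labels into a drawing. `exists_stable_of_represents` extracts them
from any drawing, bounded by `(n + 1) * (m + 1)`.

The constraints are monotone. Starting from the forced lower bounds, a violated edge is repaired by
raising `e i` to `v b` and a violated non-edge by raising `v b` to `e i + 1`; neither overtakes any
stable labelling above the start (`PartialSweep.le_of_stable`). A sweep over all pairs that changes
something raises the sum of the labels by at least one. If a representation exists, this sum stays
at most `(n + m) * ((n + 1) * (m + 1))`, so `(n + m + 1) * ((n + 1) * (m + 1))` sweeps either reach
stability or refute existence. A sweep costs `O(n * m)` for nonempty sides, and `n + m ≤ 2 * (n *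
m)` then gives the cubic bound.

The machine has no multiplication. Labels are therefore stored multiplied by `m + 2`, and
coordinates come out of them by additions and subtractions. -/

theorem mem_horizontal_segment {p q c : ℝ} (h : p ≤ q) (z : ℝ × ℝ) :
    z ∈ segment ℝ (p, c) (q, c) ↔ z.2 = c ∧ p ≤ z.1 ∧ z.1 ≤ q := by
  rw [← Prod.image_mk_segment_left, segment_eq_Icc h]
  constructor
  · rintro ⟨x, hx, rfl⟩
    exact ⟨rfl, hx.1, hx.2⟩
  · rintro ⟨h1, h2, h3⟩
    exact ⟨z.1, ⟨h2, h3⟩, by rw [← h1]⟩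

theorem mem_vertical_segment {p q c : ℝ} (h : p ≤ q) (z : ℝ × ℝ) :
    z ∈ segment ℝ (c, p) (c, q) ↔ z.1 = c ∧ p ≤ z.2 ∧ z.2 ≤ q := by
  rw [← Prod.image_mk_segment_right, segment_eq_Icc h]
  constructor
  · rintro ⟨x, hx, rfl⟩
    exact ⟨rfl, hx.1, hx.2⟩
  · rintro ⟨h1, h2, h3⟩
    exact ⟨z.2, ⟨h2, h3⟩, by rw [← h1]⟩

namespace StickDrawing

variable {A B : Type*}

/-- The only possible common point is `(D.vfoot b, D.ground - D.hfoot a)`. Of the four inequalities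
that put it on both segments, the two left/bottom ones coincide because the ground line has slope
`-1`. -/
theorem seg_inl_inter_seg_inr_nonempty {D : StickDrawing A B} {a : A} {b : B}
    (ha : D.hfoot a < D.hend a) (hb : D.ground - D.vfoot b < D.vend b) :
    (D.seg (Sum.inl a) ∩ D.seg (Sum.inr b)).Nonempty ↔
      D.hfoot a ≤ D.vfoot b ∧ D.vfoot b ≤ D.hend a ∧ D.ground - D.hfoot a ≤ D.vend b := by
  constructor
  · rintro ⟨z, h1, h2⟩
    obtain ⟨h3, h4, h5⟩ := (mem_horizontal_segment ha.le z).1 h1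
    obtain ⟨h6, h7, h8⟩ := (mem_vertical_segment hb.le z).1 h2
    refine ⟨?_, ?_, ?_⟩ <;> linarith
  · rintro ⟨h1, h2, h3⟩
    exact ⟨(D.vfoot b, D.ground - D.hfoot a),
      (mem_horizontal_segment ha.le _).2 ⟨rfl, h1, h2⟩,
      (mem_vertical_segment hb.le _).2 ⟨rfl, sub_le_sub_left h1 _, h3⟩⟩

theorem seg_inl_inter_seg_inl_nonempty {D : StickDrawing A B} {a a' : A}
    (ha : D.hfoot a < D.hend a) (ha' : D.hfoot a' < D.hend a')
    (h : (D.seg (Sum.inl a) ∩ D.seg (Sum.inl a')).Nonempty) : D.hfoot a = D.hfoot a' := by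
  obtain ⟨z, h1, h2⟩ := h
  have h3 := ((mem_horizontal_segment ha.le z).1 h1).1
  have h4 := ((mem_horizontal_segment ha'.le z).1 h2).1
  linarith

theorem seg_inr_inter_seg_inr_nonempty {D : StickDrawing A B} {b b' : B}
    (hb : D.ground - D.vfoot b < D.vend b) (hb' : D.ground - D.vfoot b' < D.vend b')
    (h : (D.seg (Sum.inr b) ∩ D.seg (Sum.inr b')).Nonempty) : D.vfoot b = D.vfoot b' := by
  obtain ⟨z, h1, h2⟩ := h
  have h3 := ((mem_vertical_segment hb.le z).1 h1).1
  have h4 := ((mem_vertical_segment hb'.le z).1 h2).1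
  linarith

/-- Parallel grounded segments can meet only if their feet coincide, so injective feet settle the
pairs within one side. -/
theorem represents_of_bipartite {D : StickDrawing A B} {G : SimpleGraph (A ⊕ B)}
    (hG : G.IsBipartiteWith (Set.range Sum.inl) (Set.range Sum.inr))
    (ha : ∀ a, D.hfoot a < D.hend a) (hb : ∀ b, D.ground - D.vfoot b < D.vend b)
    (hinjA : Function.Injective D.hfoot) (hinjB : Function.Injective D.vfoot)
    (h : ∀ a b, G.Adj (Sum.inl a) (Sum.inr b) ↔
      D.hfoot a ≤ D.vfoot b ∧ D.vfoot b ≤ D.hend a ∧ D.ground - D.hfoot a ≤ D.vend b) :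
    D.Represents G := by
  refine ⟨ha, hb, ?_⟩
  rintro (a | b) (a' | b') huv
  · constructor
    · intro hadj
      rcases hG.mem_of_adj hadj with h1 | h1 <;> simp at h1
    · intro hne
      exact absurd (congrArg Sum.inl
        (hinjA (seg_inl_inter_seg_inl_nonempty (ha a) (ha a') hne))) huv
  · rw [h, seg_inl_inter_seg_inr_nonempty (ha a) (hb b')]
  · rw [G.adj_comm, Set.inter_comm, h, seg_inl_inter_seg_inr_nonempty (ha a') (hb b)]
  · constructor
    · intro hadj
      rcases hG.mem_of_adj hadj with h1 | h1 <;> simp at h1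
    · intro hne
      exact absurd (congrArg Sum.inr
        (hinjB (seg_inr_inter_seg_inr_nonempty (hb b) (hb b') hne))) huv

end StickDrawing

/-! ### Stable labellings -/

/-- The level of the `i`-th horizontal segment on a ground line with gaps of `m` free places. -/
def level (m i : ℕ) : ℕ := (i + 1) * (m + 1)

theorem level_lt_level {m i j : ℕ} (h : i < j) : level m i < level m j :=
  Nat.mul_lt_mul_of_pos_right (by omega) (by omega)

theorem level_le_level {m i j : ℕ} (h : i ≤ j) : level m i ≤ level m j :=
  Nat.mul_le_mul_right _ (by omega)

theorem level_le_level_iff {m i j : ℕ} : level m i ≤ level m j ↔ i ≤ j :=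
  ⟨fun h => by
    by_contra h'
    exact absurd (level_lt_level (m := m) (not_le.1 h')) (not_lt.2 h), level_le_level⟩

theorem level_pos (m i : ℕ) : 0 < level m i := Nat.mul_pos (by omega) (by omega)

/-- The values `f` and `x` describe, for the vertex `b`, the levels of its first and of its last
neighbour (plus one) among the first `k` vertices of `A`; both are `0` if there is none. -/
def IsSpan (m : ℕ) (Adj : ℕ → ℕ → Prop) (b k f x : ℕ) : Prop :=
  (∀ i < k, Adj i b → f ≤ level m i ∧ level m i < x) ∧
  ((f = 0 ∧ x = 0 ∧ ∀ i < k, ¬ Adj i b) ∨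
    ((∃ i < k, Adj i b ∧ f = level m i) ∧ ∃ i < k, Adj i b ∧ x = level m i + 1))

/-- The labels `v` (places of vertical segments) and `e` (right ends of horizontal segments) meet
the adjacency constraints of `Adj`. -/
def Stable (n m : ℕ) (Adj : ℕ → ℕ → Prop) (F v e : ℕ → ℕ) : Prop :=
  ∀ b < m, ∀ i < n, (Adj i b → v b ≤ e i) ∧
    (¬ Adj i b → F b ≤ level m i → level m i < v b → e i < v b)

theorem IsSpan.zero (m : ℕ) (Adj : ℕ → ℕ → Prop) (b : ℕ) : IsSpan m Adj b 0 0 0 :=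
  ⟨by simp, Or.inl ⟨rfl, rfl, by simp⟩⟩

theorem IsSpan.succ_of_not {m : ℕ} {Adj : ℕ → ℕ → Prop} {b k f x : ℕ}
    (h : IsSpan m Adj b k f x) (hk : ¬ Adj k b) : IsSpan m Adj b (k + 1) f x := by
  refine ⟨fun i hi hA => ?_, ?_⟩
  · rcases Nat.lt_succ_iff_lt_or_eq.1 hi with h1 | rfl
    · exact h.1 i h1 hA
    · exact absurd hA hk
  · rcases h.2 with ⟨h1, h2, h3⟩ | ⟨⟨i, h1, h2⟩, ⟨j, h3, h4⟩⟩
    · refine Or.inl ⟨h1, h2, fun i hi hA => ?_⟩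
      rcases Nat.lt_succ_iff_lt_or_eq.1 hi with h4 | rfl
      · exact h3 i h4 hA
      · exact hk hA
    · exact Or.inr ⟨⟨i, by omega, h2⟩, ⟨j, by omega, h4⟩⟩

/-- Levels are positive, so the value `0` of `f` unambiguously marks that no neighbour has been seen
yet. -/
theorem IsSpan.succ_of_adj {m : ℕ} {Adj : ℕ → ℕ → Prop} {b k f x : ℕ}
    (h : IsSpan m Adj b k f x) (hk : Adj k b) :
    IsSpan m Adj b (k + 1) (if f = 0 then level m k else f) (level m k + 1) := by
  refine ⟨fun i hi hA => ⟨?_, ?_⟩, Or.inr ⟨?_, k, by omega, hk, rfl⟩⟩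
  · rcases h.2 with ⟨h1, h2, h3⟩ | ⟨⟨j, h1, h2, h3⟩, -⟩
    · rcases Nat.lt_succ_iff_lt_or_eq.1 hi with h4 | rfl
      · exact absurd hA (h3 i h4)
      · simp [h1]
    · have hf : f ≠ 0 := by rw [h3]; exact (level_pos m j).ne'
      rw [if_neg hf]
      rcases Nat.lt_succ_iff_lt_or_eq.1 hi with h4 | rfl
      · exact (h.1 i h4 hA).1
      · rw [h3]; exact level_le_level h1.le
  · exact Nat.lt_succ_of_le (level_le_level (by omega))
  · rcases h.2 with ⟨h1, h2, h3⟩ | ⟨⟨j, h1, h2, h3⟩, -⟩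
    · exact ⟨k, by omega, hk, by simp [h1]⟩
    · have hf : f ≠ 0 := by rw [h3]; exact (level_pos m j).ne'
      exact ⟨j, by omega, h2, by rw [if_neg hf, h3]⟩

theorem IsSpan.first_le {m : ℕ} {Adj : ℕ → ℕ → Prop} {b k f x : ℕ}
    (h : IsSpan m Adj b k f x) : f ≤ x := by
  rcases h.2 with ⟨h1, h2, -⟩ | ⟨⟨j, h1, h2, h3⟩, -⟩
  · omega
  · have := h.1 j h1 h2
    omega

/-- Adjacency, with the vertices of `A` numbered by their positions in the ordering `σ`. -/
def orderedAdj {n m : ℕ} (G : SimpleGraph (Fin n ⊕ Fin m)) (σ : Equiv.Perm (Fin n))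
    (i b : ℕ) : Prop :=
  ∃ (hi : i < n) (hb : b < m), G.Adj (Sum.inl (σ ⟨i, hi⟩)) (Sum.inr ⟨b, hb⟩)

/-- Each label owns a block of `m + 2` integers. Verticals use the offsets `1, …, m` of the block
(distinct for distinct `b`), horizontal feet the offset `m + 1`, right ends the offset `m + 2`.
Comparing coordinates then gives exactly `level m i < v b`, `v b ≤ e i` and `F b ≤ level m i`. -/
theorem represents_of_stable {n m : ℕ} {G : SimpleGraph (Fin n ⊕ Fin m)}
    (hG : G.IsBipartiteWith (Set.range Sum.inl) (Set.range Sum.inr)) {σ : Equiv.Perm (Fin n)}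
    {F v₀ v e : ℕ → ℕ} {g : ℕ}
    (hspan : ∀ b < m, IsSpan m (orderedAdj G σ) b n (F b) (v₀ b))
    (hv : ∀ b < m, v₀ b ≤ v b) (he : ∀ i < n, level m i ≤ e i)
    (hst : Stable n m (orderedAdj G σ) F v e) (hg : ∀ b < m, (m + 2) * F b ≤ g)
    {D : StickDrawing (Fin n) (Fin m)} (hground : D.ground = g)
    (hhfoot : ∀ i : Fin n, D.hfoot (σ i) = ((m + 2) * level m i + m + 1 : ℕ))
    (hhend : ∀ i : Fin n, D.hend (σ i) = ((m + 2) * e i + m + 2 : ℕ))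
    (hvfoot : ∀ b : Fin m, D.vfoot b = ((m + 2) * v b + b + 1 : ℕ))
    (hvend : ∀ b : Fin m, D.vend b = (g - (m + 2) * F b : ℕ)) :
    D.Represents G ∧ D.RespectsA σ := by
  have hresp : D.RespectsA σ := by
    intro i j hij
    have h1 : (m + 2) * level m i < (m + 2) * level m j :=
      Nat.mul_lt_mul_of_pos_left (level_lt_level hij) (by omega)
    simp only [hhfoot]
    exact_mod_cast (by omega)
  refine ⟨StickDrawing.represents_of_bipartite hG ?_ ?_ ?_ ?_ ?_, hresp⟩
  · intro a
    obtain ⟨i, rfl⟩ := σ.surjective a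
    rw [hhfoot, hhend]
    have h1 := Nat.mul_le_mul_left (m + 2) (he i i.2)
    exact_mod_cast (by omega)
  · intro b
    have h1 : (m + 2) * F b ≤ (m + 2) * v b :=
      Nat.mul_le_mul_left _ ((hspan b b.2).first_le.trans (hv b b.2))
    have h2 := hg b b.2
    rw [hground, hvfoot, hvend, Nat.cast_sub h2]
    have h3 : (((m + 2) * F b : ℕ) : ℝ) < (((m + 2) * v b + b + 1 : ℕ) : ℝ) := by
      exact_mod_cast (by omega)
    linarith
  · intro a a' h
    obtain ⟨i, rfl⟩ := σ.surjective a
    obtain ⟨j, rfl⟩ := σ.surjective a'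
    rw [hresp.injective h]
  · intro b b' h
    rw [hvfoot, hvfoot] at h
    -- The residue modulo `m + 2` recovers `b`, even if `v b = v b'`.
    have h1 : (m + 2) * v b + b + 1 = (m + 2) * v b' + b' + 1 := by exact_mod_cast h
    have h2 := congrArg (· % (m + 2)) h1
    simp only [add_assoc, Nat.mul_add_mod] at h2
    rw [Nat.mod_eq_of_lt (by omega), Nat.mod_eq_of_lt (by omega)] at h2
    exact Fin.ext (by omega)
  · intro a b
    obtain ⟨i, rfl⟩ := σ.surjective a
    have h2 := hg b b.2
    have hadj : G.Adj (Sum.inl (σ i)) (Sum.inr b) ↔ orderedAdj G σ i b :=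
      ⟨fun h => ⟨i.2, b.2, h⟩, fun ⟨_, _, h⟩ => h⟩
    rw [hground, hvfoot, hvend, hhfoot, hhend, Nat.cast_sub h2, sub_le_sub_iff_left, Nat.cast_le,
      Nat.cast_le, Nat.cast_le, hadj]
    have hb := b.2
    constructor
    · intro h
      have h3 := (hspan b b.2).1 i i.2 h
      have h4 := Nat.mul_le_mul_left (m + 2) h3.1
      have h5 := Nat.mul_le_mul_left (m + 2) (Nat.succ_le_of_lt (h3.2.trans_le (hv b b.2)))
      have h6 := Nat.mul_le_mul_left (m + 2) ((hst b b.2 i i.2).1 h)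
      rw [Nat.mul_succ] at h5
      omega
    · rintro ⟨h3, h4, h5⟩
      by_contra h
      have h6 : F b ≤ level m i := by
        by_contra h6
        have h7 := Nat.mul_le_mul_left (m + 2) (Nat.succ_le_of_lt (not_le.1 h6))
        rw [Nat.mul_succ] at h7
        omega
      have h7 : level m i < v b := by
        by_contra h7
        have h8 := Nat.mul_le_mul_left (m + 2) (not_lt.1 h7)
        omega
      have h8 := Nat.mul_le_mul_left (m + 2)
        (Nat.succ_le_of_lt ((hst b b.2 i i.2).2 h h6 h7))
      rw [Nat.mul_succ] at h8
      omega

/-- Only the left-to-right order of the feet in the drawing is kept: a vertical is placed by the gap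
between horizontals that contains it and by its rank among the verticals. -/
theorem exists_stable_of_represents {n m : ℕ} {G : SimpleGraph (Fin n ⊕ Fin m)}
    {σ : Equiv.Perm (Fin n)} {F v₀ : ℕ → ℕ}
    (hspan : ∀ b < m, IsSpan m (orderedAdj G σ) b n (F b) (v₀ b))
    {D : StickDrawing (Fin n) (Fin m)} (hD : D.Represents G) (hσ : D.RespectsA σ) :
    ∃ w E : ℕ → ℕ, Stable n m (orderedAdj G σ) F w E ∧ (∀ b < m, v₀ b ≤ w b) ∧
      (∀ i < n, level m i ≤ E i) ∧ (∀ b < m, w b ≤ (n + 1) * (m + 1)) ∧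
      ∀ i < n, E i ≤ (n + 1) * (m + 1) := by
  classical
  obtain ⟨ha, hb, hrep⟩ := hD
  have hadj (a : Fin n) (b : Fin m) : G.Adj (Sum.inl a) (Sum.inr b) ↔
      D.hfoot a ≤ D.vfoot b ∧ D.vfoot b ≤ D.hend a ∧ D.ground - D.hfoot a ≤ D.vend b := by
    rw [hrep _ _ (by simp), StickDrawing.seg_inl_inter_seg_inr_nonempty (ha a) (hb b)]
  -- `p b` counts the horizontals with foot not to the right of `b`, `q b` is the rank of `b`. Since
  -- `1 ≤ q b ≤ m`, the number `p b * (m + 1) + q b` falls strictly between consecutive multiples of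
  -- `m + 1`.
  let p (b : Fin m) : ℕ := (Finset.univ.filter fun i : Fin n => D.hfoot (σ i) ≤ D.vfoot b).card
  let q (b : Fin m) : ℕ := (Finset.univ.filter fun c : Fin m => D.vfoot c ≤ D.vfoot b).card
  have hp (i : Fin n) (b : Fin m) : D.hfoot (σ i) ≤ D.vfoot b ↔ (i : ℕ) < p b := by
    constructor
    · intro h
      have h1 : Finset.Iic i ⊆ Finset.univ.filter fun i : Fin n => D.hfoot (σ i) ≤ D.vfoot b := by
        intro j hj
        simp only [Finset.mem_filter, Finset.mem_univ, true_and]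
        exact (hσ.monotone (Finset.mem_Iic.1 hj)).trans h
      have h2 := Finset.card_le_card h1
      rw [Fin.card_Iic] at h2
      exact h2
    · intro h
      by_contra h'
      have h1 : (Finset.univ.filter fun i : Fin n => D.hfoot (σ i) ≤ D.vfoot b) ⊆
          Finset.Iio i := by
        intro j hj
        simp only [Finset.mem_filter, Finset.mem_univ, true_and] at hj
        rw [Finset.mem_Iio]
        exact hσ.lt_iff_lt.1 (hj.trans_lt (not_le.1 h'))
      have h2 := Finset.card_le_card h1
      rw [Fin.card_Iio] at h2
      exact absurd h (not_lt.2 h2)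
  have hpn (b : Fin m) : p b ≤ n := (Finset.card_le_univ _).trans (by simp)
  have hq1 (b : Fin m) : 0 < q b := Finset.card_pos.2 ⟨b, by simp⟩
  have hqm (b : Fin m) : q b ≤ m := (Finset.card_le_univ _).trans (by simp)
  have hpmono {b c : Fin m} (h : D.vfoot b ≤ D.vfoot c) : p b ≤ p c :=
    Finset.card_le_card (Finset.monotone_filter_right _ fun i _ hi => hi.trans h)
  have hqmono {b c : Fin m} (h : D.vfoot b < D.vfoot c) : q b < q c := by
    refine Finset.card_lt_card ⟨Finset.monotone_filter_right _ fun i _ hi => hi.trans h.le, ?_⟩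
    intro hsub
    have h1 := hsub (show c ∈ _ by simp)
    simp only [Finset.mem_filter, Finset.mem_univ, true_and] at h1
    exact absurd h1 (not_le.2 h)
  -- An isolated vertical gets the place `0`, below every level. Having `F b = 0`, it would at a
  -- larger place impose conditions that the drawing, where it may be short, need not satisfy.
  let w (b : ℕ) : ℕ := if h : b < m then
    if ∃ i < n, orderedAdj G σ i b then p ⟨b, h⟩ * (m + 1) + q ⟨b, h⟩ else 0 else 0
  have hw (b : Fin m) (h : ∃ i < n, orderedAdj G σ i b) : w b = p b * (m + 1) + q b := by
    simp only [w]
    rw [dif_pos b.2, if_pos h]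
  have hwbound (b : ℕ) : w b ≤ (n + 1) * (m + 1) := by
    simp only [w]
    split_ifs with h h'
    · have h1 := Nat.mul_le_mul_right (m + 1) (hpn ⟨b, h⟩)
      have h2 := hqm ⟨b, h⟩
      rw [Nat.succ_mul]
      omega
    · exact Nat.zero_le _
    · exact Nat.zero_le _
  have hlev (i : Fin n) (b : Fin m) (h : ∃ i < n, orderedAdj G σ i b) :
      level m i < w b ↔ D.hfoot (σ i) ≤ D.vfoot b := by
    rw [hp, hw b h, level]
    have h1 := hq1 b
    have h2 := hqm b
    constructor
    · intro h3
      by_contra h4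
      have h5 := Nat.mul_le_mul_right (m + 1) (not_lt.1 h4)
      rw [Nat.succ_mul] at h3
      omega
    · intro h3
      have h5 := Nat.mul_le_mul_right (m + 1) (Nat.succ_le_of_lt h3)
      rw [Nat.succ_eq_add_one] at h5
      omega
  have hwlt {b c : Fin m} (hb : ∃ i < n, orderedAdj G σ i b) (hc : ∃ i < n, orderedAdj G σ i c)
      (h : D.vfoot b < D.vfoot c) : w b < w c := by
    rw [hw b hb, hw c hc]
    exact add_lt_add_of_le_of_lt (Nat.mul_le_mul_right _ (hpmono h.le)) (hqmono h)
  have hadjlev {i b : ℕ} (h : orderedAdj G σ i b) : level m i < w b := by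
    obtain ⟨hi, hb, h1⟩ := h
    exact (hlev ⟨i, hi⟩ ⟨b, hb⟩ ⟨i, hi, hi, hb, h1⟩).2 ((hadj _ _).1 h1).1
  -- The shortest horizontal segment that still reaches all its neighbours.
  let E (i : ℕ) : ℕ :=
    max (level m i) (((Finset.range m).filter fun b => orderedAdj G σ i b).sup w)
  refine ⟨w, E, ?_, ?_, fun i _ => le_max_left _ _, fun b _ => hwbound b, ?_⟩
  · intro b hb' i hi
    refine ⟨fun h => le_max_of_le_right (Finset.le_sup (f := w) (by simp [hb', h])), ?_⟩
    intro hnadj hF hlt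
    have hiso : ∃ i < n, orderedAdj G σ i b := by
      by_contra h
      have h1 : w b = 0 := by simp [w, h]
      omega
    refine max_lt hlt ((Finset.sup_lt_iff (by rw [bot_eq_zero]; omega)).2 fun c hc => ?_)
    simp only [Finset.mem_filter, Finset.mem_range] at hc
    obtain ⟨hcm, hc⟩ := hc
    obtain ⟨j, hj, hjadj, hFj⟩ : ∃ j < n, orderedAdj G σ j b ∧ F b = level m j := by
      rcases (hspan b hb').2 with ⟨-, -, h⟩ | ⟨h, -⟩
      · obtain ⟨i, hi, h1⟩ := hiso
        exact absurd h1 (h i hi)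
      · exact h
    rw [hFj, level_le_level_iff] at hF
    obtain ⟨_, _, hjadj⟩ := hjadj
    obtain ⟨_, _, hc'⟩ := hc
    have h1 := (hlev ⟨i, hi⟩ ⟨b, hb'⟩ hiso).1 hlt
    have h2 := (hadj _ _).1 hjadj
    have h3 := (hadj _ _).1 hc'
    have h4 : D.hfoot (σ ⟨j, hj⟩) ≤ D.hfoot (σ ⟨i, hi⟩) := hσ.monotone hF
    -- The vertical `b` reaches up to its first neighbour `j`, which is at least as high as `i`. So
    -- `b` crosses the height of `i`, and a non-neighbour `i` must end before it.
    have h5 : D.hend (σ ⟨i, hi⟩) < D.vfoot ⟨b, hb'⟩ := by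
      by_contra h5
      exact hnadj ⟨hi, hb', (hadj _ _).2 ⟨h1, not_lt.1 h5, by linarith [h2.2.2]⟩⟩
    exact hwlt (b := ⟨c, hcm⟩) (c := ⟨b, hb'⟩) ⟨i, hi, hi, hcm, hc'⟩ hiso (h3.2.1.trans_lt h5)
  · intro b hb'
    rcases (hspan b hb').2 with ⟨-, h, -⟩ | ⟨-, ⟨i, hi, h1, h2⟩⟩
    · rw [h]; exact Nat.zero_le _
    · rw [h2]; exact hadjlev h1
  · intro i hi
    exact max_le (Nat.mul_le_mul_right _ (by omega)) (Finset.sup_le fun b _ => hwbound b)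

/-! ### Relaxation sweeps -/

/-- The result `(v, e)` of relaxing the labels `(v₀, e₀)` at all pairs `(b, i)` with `b < k`, and
`(k, i)` with `i < j`; `flag` is `1` if a label has changed and `0` otherwise. -/
structure PartialSweep (n m : ℕ) (Adj : ℕ → ℕ → Prop) (F v₀ e₀ : ℕ → ℕ) (k j : ℕ)
    (v e : ℕ → ℕ) (flag : ℕ) : Prop where
  le_v : ∀ b < m, v₀ b ≤ v b
  le_e : ∀ i < n, e₀ i ≤ e i
  flag_le : flag ≤ 1
  sum_le : ∑ b ∈ Finset.range m, v₀ b + ∑ i ∈ Finset.range n, e₀ i + flag ≤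
    ∑ b ∈ Finset.range m, v b + ∑ i ∈ Finset.range n, e i
  le_of_stable : ∀ w E : ℕ → ℕ, Stable n m Adj F w E → (∀ b < m, v₀ b ≤ w b) →
    (∀ i < n, e₀ i ≤ E i) → (∀ b < m, v b ≤ w b) ∧ ∀ i < n, e i ≤ E i
  stable : flag = 0 → ∀ b < m, ∀ i < n, b < k ∨ (b = k ∧ i < j) →
    (Adj i b → v b ≤ e i) ∧ (¬ Adj i b → F b ≤ level m i → level m i < v b → e i < v b)

namespace PartialSweep

variable {n m : ℕ} {Adj : ℕ → ℕ → Prop} {F v₀ e₀ v e : ℕ → ℕ} {k j flag : ℕ}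

theorem refl (v e : ℕ → ℕ) : PartialSweep n m Adj F v e 0 0 v e 0 where
  le_v := fun _ _ => le_rfl
  le_e := fun _ _ => le_rfl
  flag_le := by omega
  sum_le := le_rfl
  le_of_stable := fun _ _ _ h1 h2 => ⟨h1, h2⟩
  stable := fun _ b _ i _ h => by omega

theorem next_row (h : PartialSweep n m Adj F v₀ e₀ k n v e flag) :
    PartialSweep n m Adj F v₀ e₀ (k + 1) 0 v e flag :=
  { h with stable := fun h0 b hb i hi hbk => h.stable h0 b hb i hi (by omega) }

/-- With flag `0` no label has changed, so checks made earlier in the sweep remain valid; with flag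
`1` the field `stable` is vacuous. -/
theorem keep (h : PartialSweep n m Adj F v₀ e₀ k j v e flag)
    (h1 : Adj j k → v k ≤ e j)
    (h2 : ¬ Adj j k → F k ≤ level m j → level m j < v k → e j < v k) :
    PartialSweep n m Adj F v₀ e₀ k (j + 1) v e flag := by
  refine { h with stable := fun h0 b hb i hi hbk => ?_ }
  by_cases h3 : b = k ∧ i = j
  · obtain ⟨rfl, rfl⟩ := h3
    exact ⟨h1, h2⟩
  · exact h.stable h0 b hb i hi (by omega)

theorem sum_update_of_lt {N a x : ℕ} {f : ℕ → ℕ} (ha : a < N) (hx : f a < x) :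
    ∑ i ∈ Finset.range N, f i + 1 ≤ ∑ i ∈ Finset.range N, Function.update f a x i := by
  refine Nat.succ_le_of_lt (Finset.sum_lt_sum (fun i _ => ?_) ⟨a, by simpa using ha, by simpa⟩)
  rcases eq_or_ne i a with rfl | h
  · simpa using hx.le
  · simp [h]

theorem raise_e (h : PartialSweep n m Adj F v₀ e₀ k j v e flag) (hk : k < m) (hj : j < n)
    (hA : Adj j k) (hlt : e j < v k) :
    PartialSweep n m Adj F v₀ e₀ k (j + 1) v (Function.update e j (v k)) 1 where
  le_v := h.le_v
  le_e := fun i hi => by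
    rcases eq_or_ne i j with rfl | hij
    · simpa using (h.le_e i hi).trans hlt.le
    · simpa [hij] using h.le_e i hi
  flag_le := le_rfl
  sum_le := by
    have h1 := h.sum_le
    have h2 := sum_update_of_lt hj hlt
    omega
  le_of_stable := fun w E hst hw hE => by
    obtain ⟨h1, h2⟩ := h.le_of_stable w E hst hw hE
    refine ⟨h1, fun i hi => ?_⟩
    rcases eq_or_ne i j with rfl | hij
    · simpa using (h1 k hk).trans ((hst k hk i hi).1 hA)
    · simpa [hij] using h2 i hi
  stable := by simp

/-- Monotonicity enters here: `level m j < v k` persists for any larger stable `w k`, which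
therefore exceeds `E j ≥ e j`. -/
theorem raise_v (h : PartialSweep n m Adj F v₀ e₀ k j v e flag) (hk : k < m) (hj : j < n)
    (hA : ¬ Adj j k) (hF : F k ≤ level m j) (hl : level m j < v k) (hlt : v k ≤ e j) :
    PartialSweep n m Adj F v₀ e₀ k (j + 1) (Function.update v k (e j + 1)) e 1 where
  le_v := fun b hb => by
    rcases eq_or_ne b k with rfl | hij
    · have := h.le_v b hb
      simp only [Function.update_self]
      omega
    · simpa [hij] using h.le_v b hb
  le_e := h.le_e
  flag_le := le_rfl
  sum_le := by
    have h1 := h.sum_le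
    have h2 := sum_update_of_lt hk (Nat.lt_succ_of_le hlt)
    rw [Nat.succ_eq_add_one] at h2
    omega
  le_of_stable := fun w E hst hw hE => by
    obtain ⟨h1, h2⟩ := h.le_of_stable w E hst hw hE
    refine ⟨fun b hb => ?_, h2⟩
    rcases eq_or_ne b k with rfl | hij
    · have h3 := (hst b hb j hj).2 hA hF (hl.trans_le (h1 b hb))
      have h4 := h2 j hj
      simp only [Function.update_self]
      omega
    · simpa [hij] using h1 b hb
  stable := by simp

end PartialSweep

/-! ### Running-time triples for the random access machine -/

namespace RamState

@[simp] theorem reg_setReg (s : RamState) (x v y : ℕ) :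
    (s.setReg x v).reg y = if y = x then v else s.reg y := by
  simp [setReg, Function.update_apply]

@[simp] theorem arr_setReg (s : RamState) (x v : ℕ) : (s.setReg x v).arr = s.arr := rfl

@[simp] theorem reg_setArr (s : RamState) (k i v : ℕ) : (s.setArr k i v).reg = s.reg := rfl

@[simp] theorem arr_setArr (s : RamState) (k i v l j : ℕ) :
    (s.setArr k i v).arr l j = if l = k ∧ j = i then v else s.arr l j := by
  by_cases hl : l = k
  · subst hl
    simp [setArr, Function.update_apply]
  · simp [setArr, hl]

end RamState

/-- Started in `s`, the program `p` halts within `T` steps in a state that satisfies `Q`. -/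
def Runs (p : RamProgram) (s : RamState) (T : ℕ) (Q : RamState → Prop) : Prop :=
  ∃ t s', RamExec p s t s' ∧ t ≤ T ∧ Q s'

namespace RamProgram

/-- A program without loops. -/
def loopFree : RamProgram → Bool
  | seq p q => loopFree p && loopFree q
  | ite _ p q => loopFree p && loopFree q
  | loop _ _ => false
  | _ => true

/-- A bound for the number of steps of a program without loops. -/
def cost : RamProgram → ℕ
  | seq p q => cost p + cost q
  | ite _ p q => cost p + cost q + 1
  | _ => 1

open Classical in
/-- The effect of a program without loops. -/
noncomputable def eval : RamProgram → RamState → RamState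
  | skip, s => s
  | const x c, s => s.setReg x c
  | copy x y, s => s.setReg x (s.reg y)
  | add x y z, s => s.setReg x (s.reg y + s.reg z)
  | sub x y z, s => s.setReg x (s.reg y - s.reg z)
  | load x k y, s => s.setReg x (s.arr k (s.reg y))
  | store k x y, s => s.setArr k (s.reg x) (s.reg y)
  | seq p q, s => eval q (eval p s)
  | ite b p q, s => if b.holds s then eval p s else eval q s
  | loop _ _, s => s

/-- `for x := 0, …, (value of y) - 1 do p`, where register `2` holds the constant `1`. -/
def forLoop (x y : ℕ) (p : RamProgram) : RamProgram :=
  seq (const x 0) (loop (.lt x y) (seq p (add x x 2)))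

/-- `d := x * y`, with the counter `c`. -/
def mul (d x y c : ℕ) : RamProgram :=
  seq (const d 0) (forLoop c x (add d d y))

/-- Run `p` for all pairs of a number below register `1` (the outer loop, with counter `10`) and a
number below register `0` (the inner loop, with counter `11`). -/
def forPairs (p : RamProgram) : RamProgram :=
  forLoop 10 1 (forLoop 11 0 p)

end RamProgram

/-! ### Proof rules for running-time triples -/

namespace Runs

open RamProgram

variable {p q : RamProgram} {s : RamState} {T T' : ℕ} {Q Q' : RamState → Prop}

theorem mono (h : Runs p s T Q) (hQ : ∀ s', Q s' → Q' s') : Runs p s T Q' := by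
  obtain ⟨t, s', h1, h2, h3⟩ := h
  exact ⟨t, s', h1, h2, hQ s' h3⟩

theorem mono_time (h : Runs p s T Q) (hT : T ≤ T') : Runs p s T' Q := by
  obtain ⟨t, s', h1, h2, h3⟩ := h
  exact ⟨t, s', h1, h2.trans hT, h3⟩

theorem seq (h : Runs p s T fun s' => Runs q s' T' Q) : Runs (.seq p q) s (T + T') Q := by
  obtain ⟨t, s', h1, h2, t', s'', h3, h4, h5⟩ := h
  exact ⟨t + t', s'', .seq h1 h3, add_le_add h2 h4, h5⟩

theorem ite {b : RamTest} (hp : b.holds s → Runs p s T Q) (hq : ¬ b.holds s → Runs q s T Q) :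
    Runs (.ite b p q) s (T + 1) Q := by
  by_cases hb : b.holds s
  · obtain ⟨t, s', h1, h2, h3⟩ := hp hb
    exact ⟨t + 1, s', .ite_true hb h1, by omega, h3⟩
  · obtain ⟨t, s', h1, h2, h3⟩ := hq hb
    exact ⟨t + 1, s', .ite_false hb h1, by omega, h3⟩

theorem of_loopFree (hp : p.loopFree = true) (hQ : Q (p.eval s)) : Runs p s p.cost Q := by
  suffices h : ∃ t, RamExec p s t (p.eval s) ∧ t ≤ p.cost by
    obtain ⟨t, h1, h2⟩ := h
    exact ⟨t, _, h1, h2, hQ⟩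
  clear hQ
  induction p generalizing s with
  | skip => exact ⟨1, .skip s, le_rfl⟩
  | const x c => exact ⟨1, .const x c s, le_rfl⟩
  | copy x y => exact ⟨1, .copy x y s, le_rfl⟩
  | add x y z => exact ⟨1, .add x y z s, le_rfl⟩
  | sub x y z => exact ⟨1, .sub x y z s, le_rfl⟩
  | load x k y => exact ⟨1, .load x k y s, le_rfl⟩
  | store k x y => exact ⟨1, .store k x y s, le_rfl⟩
  | seq p q hp' hq' =>
    simp only [loopFree, Bool.and_eq_true] at hp
    obtain ⟨t, h1, h2⟩ := hp' (s := s) hp.1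
    obtain ⟨t', h3, h4⟩ := hq' (s := p.eval s) hp.2
    exact ⟨t + t', .seq h1 h3, add_le_add h2 h4⟩
  | ite b p q hp' hq' =>
    simp only [loopFree, Bool.and_eq_true] at hp
    by_cases hb : b.holds s
    · obtain ⟨t, h1, h2⟩ := hp' (s := s) hp.1
      refine ⟨t + 1, ?_, by simp only [cost]; omega⟩
      simp only [eval, if_pos hb]
      exact .ite_true hb h1
    · obtain ⟨t, h1, h2⟩ := hq' (s := s) hp.2
      refine ⟨t + 1, ?_, by simp only [cost]; omega⟩
      simp only [eval, if_neg hb]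
      exact .ite_false hb h1
  | loop b p _ => simp [loopFree] at hp

/-- Each round pays `2` beyond the body, for the test and the increment; the final `2` pays for the
initialisation and the failing test. -/
theorem forLoop {x y N : ℕ} {I : ℕ → RamState → Prop} (h0 : I 0 (s.setReg x 0))
    (hx : ∀ k s, I k s → s.reg x = k ∧ s.reg y = N)
    (step : ∀ k < N, ∀ s, I k s →
      Runs p s T fun s' => I (k + 1) (s'.setReg x (s'.reg x + s'.reg 2))) :
    Runs (forLoop x y p) s (N * (T + 2) + 2) (I N) := by
  -- Induction on the number `d` of rounds still to come.
  have key : ∀ d k s, k + d = N → I k s →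
      Runs (.loop (.lt x y) (.seq p (.add x x 2))) s (d * (T + 2) + 1) (I N) := by
    intro d
    induction d with
    | zero =>
      intro k s hk hI
      obtain ⟨h1, h2⟩ := hx k s hI
      refine ⟨1, s, .loop_done ?_, by omega, ?_⟩
      · simp only [RamTest.holds]
        omega
      · rwa [← hk, add_zero]
    | succ d ih =>
      intro k s hk hI
      obtain ⟨h1, h2⟩ := hx k s hI
      obtain ⟨t, s', h3, h4, h5⟩ := step k (by omega) s hI
      obtain ⟨t', s'', h6, h7, h8⟩ := ih (k + 1) _ (by omega) h5
      refine ⟨t + 1 + t' + 1, s'', .loop_step ?_ (.seq h3 (.add x x 2 s')) h6, ?_, h8⟩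
      · simp only [RamTest.holds]
        omega
      · rw [Nat.succ_mul]
        omega
  obtain ⟨t, s', h1, h2, h3⟩ := key N 0 _ (by omega) h0
  exact ⟨1 + t, s', .seq (.const x 0 s) h1, by omega, h3⟩

theorem mul {d x y c X Y : ℕ} (hx : s.reg x = X) (hy : s.reg y = Y) (h2 : s.reg 2 = 1)
    (hd : d ∉ [x, y, c, 2]) (hc : c ∉ [x, y, 2]) :
    Runs (mul d x y c) s (X * 3 + 3) fun s' =>
      (∀ z, z ≠ d → z ≠ c → s'.reg z = s.reg z) ∧ s'.arr = s.arr ∧ s'.reg d = X * Y := by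
  simp only [List.mem_cons, List.not_mem_nil, or_false, not_or] at hd hc
  obtain ⟨hdx, hdy, hdc, hd2⟩ := hd
  obtain ⟨hcx, hcy, hc2⟩ := hc
  have key := Runs.forLoop (p := .add d d y) (s := s.setReg d 0) (x := c) (y := x) (T := 1) (N := X)
    (I := fun k s' => s'.reg c = k ∧ (∀ z, z ≠ d → z ≠ c → s'.reg z = s.reg z) ∧
      s'.arr = s.arr ∧ s'.reg d = k * Y) ?_ ?_ ?_
  · refine mono_time (seq (T := 1) (T' := X * (1 + 2) + 2) ?_) (by omega)
    exact of_loopFree rfl (key.mono fun s' h => h.2)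
  · refine ⟨by simp, fun z hz hz' => by simp [hz, hz'], by simp, by simp [hdc]⟩
  · rintro k s' ⟨h3, h4, -⟩
    exact ⟨h3, by rw [h4 x (Ne.symm hdx) (Ne.symm hcx), hx]⟩
  · rintro k hk s' ⟨h3, h4, h5, h6⟩
    refine of_loopFree (p := .add d d y) rfl ⟨?_, fun z hz hz' => ?_, ?_, ?_⟩
    · have := h4 2 (Ne.symm hd2) (Ne.symm hc2)
      simp [eval, Ne.symm hdc, Ne.symm hd2, h3, this, h2]
    · simp [eval, hz, hz', h4 z hz hz']
    · simp [eval, h5]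
    · have := h4 y (Ne.symm hdy) (Ne.symm hcy)
      simp only [eval, RamState.reg_setReg, if_neg hdc, if_true, h6, this, hy]
      ring

/-- The invariant `J` must not see the counters `10` and `11`; `hrow` identifies the end of a row
with the start of the next. -/
theorem forPairs {n m : ℕ} {J : ℕ → ℕ → RamState → Prop}
    (hreg : ∀ k j s, J k j s → s.reg 0 = n ∧ s.reg 1 = m ∧ s.reg 2 = 1)
    (hset : ∀ k j s x v, x = 10 ∨ x = 11 → J k j s → J k j (s.setReg x v))
    (hrow : ∀ k < m, ∀ s, J k n s → J (k + 1) 0 s)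
    (step : ∀ k < m, ∀ j < n, ∀ s, J k j s → s.reg 10 = k → s.reg 11 = j →
      Runs p s T fun s' => J k (j + 1) s' ∧ s'.reg 10 = k ∧ s'.reg 11 = j)
    (h0 : J 0 0 s) :
    Runs (forPairs p) s (m * (n * (T + 2) + 4) + 2) (J m 0) := by
  have key := Runs.forLoop (p := RamProgram.forLoop 11 0 p) (s := s) (x := 10) (y := 1) (N := m)
    (T := n * (T + 2) + 2) (I := fun k s' => s'.reg 10 = k ∧ J k 0 s') ?_ ?_ ?_
  · exact (key.mono fun s' h => h.2).mono_time (by rw [add_assoc])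
  · exact ⟨by simp, hset _ _ _ _ _ (Or.inl rfl) h0⟩
  · rintro k s' ⟨h1, h2⟩
    exact ⟨h1, (hreg _ _ _ h2).2.1⟩
  · rintro k hk s' ⟨h1, h2⟩
    refine (Runs.forLoop (p := p) (s := s') (x := 11) (y := 0) (N := n) (T := T)
      (I := fun j s' => s'.reg 11 = j ∧ s'.reg 10 = k ∧ J k j s') ?_ ?_ ?_).mono ?_
    · exact ⟨by simp, by simpa using h1, hset _ _ _ _ _ (Or.inr rfl) h2⟩
    · rintro j s' ⟨h3, h4, h5⟩
      exact ⟨h3, (hreg _ _ _ h5).1⟩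
    · rintro j hj s' ⟨h3, h4, h5⟩
      refine (step k hk j hj s' h5 h4 h3).mono ?_
      rintro s'' ⟨h6, h7, h8⟩
      have h9 := (hreg _ _ _ h6).2.2
      exact ⟨by simp [h8, h9], by simpa using h7, hset _ _ _ _ _ (Or.inr rfl) h6⟩
    · rintro s'' ⟨h3, h4, h5⟩
      have h6 := hrow k hk _ h5
      have h7 := (hreg _ _ _ h6).2.2
      exact ⟨by simp [h4, h7], hset _ _ _ _ _ (Or.inl rfl) h6⟩

end Runs

/-! ### The program -/

namespace RamProgram

/-- Fill in the constants: `m + 2` in register `4`, `m + 1` in `12`, `n + 1` in `13`, `n + m + 1`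
in `14`. -/
def fixedAPrepare : RamProgram :=
  seq (const 2 1) (seq (add 12 1 2) (seq (add 4 12 2) (seq (add 13 0 2) (seq (add 14 0 12)
    (const 9 1)))))

/-- Compute the level of the `i`-th horizontal segment and the offset of the row `i` of the
adjacency matrix. -/
def fixedALevel : RamProgram :=
  seq (load 12 1 11) (seq (store 9 11 12) (seq (add 7 7 5) (seq (store 7 11 7)
    (seq (store 6 11 7) (seq (store 4 11 8) (add 8 8 1))))))

/-- Load the entry of the adjacency matrix for the current pair into register `12`. -/
def fixedAEntry : RamProgram :=
  seq (load 12 9 11) (seq (load 12 4 12) (seq (add 12 12 10) (load 12 0 12)))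

/-- Update the levels of the first and the last neighbour. -/
def fixedASpan : RamProgram :=
  seq fixedAEntry
    (ite (.eq 12 2)
      (seq (load 13 7 11) (seq (add 14 13 4) (seq (store 5 10 14) (seq (load 14 8 10)
        (ite (.eq 14 3) (store 8 10 13) skip)))))
      skip)

/-- Relax the labels of the current pair. -/
def fixedARelax : RamProgram :=
  seq fixedAEntry (seq (load 13 5 10) (seq (load 14 6 11)
    (ite (.eq 12 2)
      (ite (.lt 14 13) (seq (store 6 11 13) (const 9 1)) skip)
      (seq (load 15 7 11) (seq (load 16 8 10)
        (ite (.lt 15 16) skip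
          (ite (.lt 15 13)
            (ite (.lt 14 13) skip (seq (add 16 14 4) (seq (store 5 10 16) (const 9 1))))
            skip)))))))

/-- Relax all pairs, unless the labels are known to be stable. -/
def fixedARound : RamProgram :=
  ite (.eq 9 2) (seq (const 9 0) (forPairs fixedARelax)) skip

/-- Write the coordinates of a horizontal segment. -/
def fixedAWriteH : RamProgram :=
  seq (load 12 9 11) (seq (load 13 7 11) (seq (add 13 13 4) (seq (sub 13 13 2)
    (seq (store 0 12 13) (seq (load 13 6 11) (seq (add 13 13 4) (store 1 12 13)))))))

/-- Write the coordinates of a vertical segment. -/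
def fixedAWriteV : RamProgram :=
  seq (load 12 5 10) (seq (add 12 12 10) (seq (add 12 12 2) (seq (store 2 10 12)
    (seq (load 12 8 10) (seq (sub 12 7 12) (store 3 10 12))))))

/-- Write the answer and the drawing. -/
def fixedAOutput : RamProgram :=
  ite (.eq 9 3)
    (seq (forLoop 11 0 fixedAWriteH) (seq (forLoop 10 1 fixedAWriteV)
      (seq (copy 1 7) (const 0 1))))
    (const 0 0)

/-- The program for the fixed-`A` Stick problem. -/
def fixedAStick : RamProgram :=
  seq fixedAPrepare (seq (mul 5 12 4 20) (seq (mul 15 13 12 20) (seq (mul 6 14 15 20)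
    (seq (forLoop 11 0 fixedALevel) (seq (forPairs fixedASpan)
      (seq (forLoop 20 6 fixedARound) fixedAOutput))))))

end RamProgram

/-! ### Correctness of the parts of the program -/

/-- The contents of the registers and arrays that are fixed after the precomputation. -/
structure Prepared (n m : ℕ) (Adj : ℕ → ℕ → Prop) (σ : ℕ → ℕ) (s : RamState) : Prop where
  reg_zero : s.reg 0 = n
  reg_one : s.reg 1 = m
  reg_two : s.reg 2 = 1
  reg_three : s.reg 3 = 0
  reg_four : s.reg 4 = m + 2
  reg_six : s.reg 6 = (n + m + 1) * ((n + 1) * (m + 1))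
  reg_seven : s.reg 7 = n * ((m + 1) * (m + 2))
  entry_of_adj : ∀ i < n, ∀ b < m, Adj i b → s.arr 0 (s.arr 4 (s.arr 9 i) + b) = 1
  entry_of_not_adj : ∀ i < n, ∀ b < m, ¬ Adj i b → s.arr 0 (s.arr 4 (s.arr 9 i) + b) = 0
  perm : ∀ i < n, s.arr 9 i = σ i
  levels : ∀ i < n, s.arr 7 i = (m + 2) * level m i

namespace Prepared

variable {n m : ℕ} {Adj : ℕ → ℕ → Prop} {σ : ℕ → ℕ} {s : RamState}

theorem setReg (h : Prepared n m Adj σ s) {x : ℕ} (hx : 7 < x) (v : ℕ) :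
    Prepared n m Adj σ (s.setReg x v) := by
  have hne : ∀ y ≤ 7, (s.setReg x v).reg y = s.reg y := fun y hy => by
    rw [RamState.reg_setReg, if_neg (by omega)]
  exact ⟨(hne _ (by omega)).trans h.1, (hne _ (by omega)).trans h.2, (hne _ (by omega)).trans h.3,
    (hne _ (by omega)).trans h.4, (hne _ (by omega)).trans h.5, (hne _ (by omega)).trans h.6,
    (hne _ (by omega)).trans h.7, h.8, h.9, h.10, h.11⟩

theorem setArr (h : Prepared n m Adj σ s) {k : ℕ} (hk : k = 5 ∨ k = 6 ∨ k = 8) (i v : ℕ) :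
    Prepared n m Adj σ (s.setArr k i v) := by
  have hne : ∀ l, l = 0 ∨ l = 4 ∨ l = 7 ∨ l = 9 → (s.setArr k i v).arr l = s.arr l :=
    fun l hl => by
      ext j
      rw [RamState.arr_setArr, if_neg (by omega)]
  have h0 := hne 0 (by omega)
  have h4 := hne 4 (by omega)
  have h7 := hne 7 (by omega)
  have h9 := hne 9 (by omega)
  exact ⟨h.1, h.2, h.3, h.4, h.5, h.6, h.7, by rw [h0, h4, h9]; exact h.8,
    by rw [h0, h4, h9]; exact h.9, by rw [h9]; exact h.10, by rw [h7]; exact h.11⟩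

end Prepared

open RamProgram

/-! ### One step of the span computation and of the relaxation -/

section

variable {n m : ℕ} {Adj : ℕ → ℕ → Prop} {σ : ℕ → ℕ} {s : RamState}

/-- Array `8` holds the scaled levels of the first neighbours, arrays `5` and `6` hold the scaled
labels `v` and `e`. -/
def HasLabels (n m : ℕ) (F v e : ℕ → ℕ) (s : RamState) : Prop :=
  (∀ b < m, s.arr 8 b = (m + 2) * F b) ∧ (∀ b < m, s.arr 5 b = (m + 2) * v b) ∧
    ∀ i < n, s.arr 6 i = (m + 2) * e i

theorem runs_fixedASpan (hs : Prepared n m Adj σ s) {F v e : ℕ → ℕ} (hl : HasLabels n m F v e s)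
    {k j : ℕ} (hk : k < m) (hj : j < n) (h10 : s.reg 10 = k) (h11 : s.reg 11 = j)
    (hspan : IsSpan m Adj k j (F k) (v k)) :
    Runs fixedASpan s 13 fun s' =>
      (Prepared n m Adj σ s' ∧ ∃ f x, IsSpan m Adj k (j + 1) f x ∧
        HasLabels n m (Function.update F k f) (Function.update v k x) e s') ∧
      s'.reg 10 = k ∧ s'.reg 11 = j ∧ s'.reg 9 = s.reg 9 := by
  obtain ⟨hF, hv, he⟩ := hl
  refine Runs.of_loopFree (p := fixedASpan) rfl ?_
  have h1 := hs.levels j hj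
  by_cases hA : Adj j k
  · have h2 := hs.entry_of_adj j hj k hk hA
    have h3 := hspan.succ_of_adj hA
    have h4 : (m + 2) * F k = 0 ↔ F k = 0 := by simp
    simp only [fixedASpan, fixedAEntry, eval, RamTest.holds, RamState.reg_setReg,
      RamState.arr_setReg, RamState.reg_setArr, RamState.arr_setArr, h10, h11, h2, h1,
      hs.reg_two, hs.reg_three, hs.reg_four, hF k hk, h4, Nat.reduceEqDiff, if_true, if_false,
      and_true]
    have hx : (m + 2) * level m j + (m + 2) = (m + 2) * (level m j + 1) := by ring
    split_ifs with h5
    all_goals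
      first | rw [if_pos h5] at h3 | rw [if_neg h5] at h3
      refine ⟨⟨?_, _, _, h3, ?_, ?_, ?_⟩, ?_, ?_, ?_⟩
      · repeat' first | exact hs | apply Prepared.setReg _ (by omega) |
          apply Prepared.setArr _ (by omega)
      · intro b hb
        rcases eq_or_ne b k with rfl | hbk
        · simp [hF b hb]
        · simp [hF b hb, hbk]
      · intro b hb
        rcases eq_or_ne b k with rfl | hbk
        · simp [hx]
        · simp [hv b hb, hbk]
      · intro i hi
        simp [he i hi]
      · simp [h10]
      · simp [h11]
      · simp
  · have h2 := hs.entry_of_not_adj j hj k hk hA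
    simp only [fixedASpan, fixedAEntry, eval, RamTest.holds, RamState.reg_setReg,
      RamState.arr_setReg, h10, h11, h2,
      hs.reg_two, Nat.reduceEqDiff, if_true, if_false, zero_ne_one]
    refine ⟨⟨?_, _, _, hspan.succ_of_not hA, ?_, ?_, ?_⟩, ?_, ?_, ?_⟩
    · repeat' first | exact hs | apply Prepared.setReg _ (by omega)
    · simpa using hF
    · simpa using hv
    · simpa using he
    · simp
    · simp
    · simp

theorem runs_fixedARelax (hs : Prepared n m Adj σ s) {F v₀ e₀ v e : ℕ → ℕ}
    (hl : HasLabels n m F v e s) {k j : ℕ} (hk : k < m) (hj : j < n) (h10 : s.reg 10 = k)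
    (h11 : s.reg 11 = j) (hsw : PartialSweep n m Adj F v₀ e₀ k j v e (s.reg 9)) :
    Runs fixedARelax s 22 fun s' =>
      (Prepared n m Adj σ s' ∧ ∃ v' e', HasLabels n m F v' e' s' ∧
        PartialSweep n m Adj F v₀ e₀ k (j + 1) v' e' (s'.reg 9)) ∧
      s'.reg 10 = k ∧ s'.reg 11 = j ∧ s'.reg 20 = s.reg 20 := by
  obtain ⟨hF, hv, he⟩ := hl
  refine Runs.of_loopFree (p := fixedARelax) rfl ?_
  have h1 := hs.levels j hj
  have hlt : ∀ x y : ℕ, (m + 2) * x < (m + 2) * y ↔ x < y :=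
    fun x y => Nat.mul_lt_mul_left (by omega)
  by_cases hA : Adj j k
  · have h2 := hs.entry_of_adj j hj k hk hA
    simp only [fixedARelax, fixedAEntry, eval, RamTest.holds, RamState.reg_setReg,
      RamState.arr_setReg, h10, h11, h2,
      hs.reg_two, hv k hk, he j hj, hlt, Nat.reduceEqDiff, if_true, if_false]
    split_ifs with h5
    · refine ⟨⟨?_, v, Function.update e j (v k), ⟨?_, ?_, ?_⟩, ?_⟩, ?_, ?_, ?_⟩
      · repeat' first | exact hs | apply Prepared.setReg _ (by omega) |
          apply Prepared.setArr _ (by omega)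
      · simpa using hF
      · simpa using hv
      · intro i hi
        rcases eq_or_ne i j with rfl | hij
        · simp
        · simp [he i hi, hij]
      · simpa using hsw.raise_e hk hj hA h5
      · simp [h10]
      · simp [h11]
      · simp
    · refine ⟨⟨?_, v, e, ⟨?_, ?_, ?_⟩, ?_⟩, ?_, ?_, ?_⟩
      · repeat' first | exact hs | apply Prepared.setReg _ (by omega)
      · simpa using hF
      · simpa using hv
      · simpa using he
      · simpa using hsw.keep (fun _ => not_lt.1 h5) (fun h => absurd hA h)
      · simp [h10]
      · simp [h11]
      · simp
  · have h2 := hs.entry_of_not_adj j hj k hk hA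
    have hx : (m + 2) * e j + (m + 2) = (m + 2) * (e j + 1) := by ring
    simp only [fixedARelax, fixedAEntry, eval, RamTest.holds, RamState.reg_setReg,
      RamState.arr_setReg, h10, h11, h2, h1, hF k hk,
      hs.reg_two, hv k hk, he j hj, hlt, Nat.reduceEqDiff, if_true, if_false, zero_ne_one]
    split_ifs with h5 h6 h7
    -- Brings forward the only case that writes: the non-edge constraint is active and violated.
    rotate_left 2
    · refine ⟨⟨?_, Function.update v k (e j + 1), e, ⟨?_, ?_, ?_⟩, ?_⟩, ?_, ?_, ?_⟩
      · repeat' first | exact hs | apply Prepared.setReg _ (by omega) |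
          apply Prepared.setArr _ (by omega)
      · simpa using hF
      · intro b hb
        rcases eq_or_ne b k with rfl | hbk
        · simp [hs.reg_four, hx]
        · simp [hv b hb, hbk]
      · simpa using he
      · simpa using hsw.raise_v hk hj hA (not_lt.1 h5) h6 (not_lt.1 h7)
      · simp [h10]
      · simp [h11]
      · simp
    all_goals
      refine ⟨⟨?_, v, e, ⟨?_, ?_, ?_⟩, ?_⟩, ?_, ?_, ?_⟩
      · repeat' first | exact hs | apply Prepared.setReg _ (by omega)
      · simpa using hF
      · simpa using hv
      · simpa using he
      · simpa using hsw.keep (fun h => absurd h hA) (fun _ _ _ => by omega)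
      · simp [h10]
      · simp [h11]
      · simp

end

/-! ### Loops: spans, sweeps, rounds, precomputation and output -/

section

variable {n m : ℕ} {Adj : ℕ → ℕ → Prop} {σ : ℕ → ℕ} {s : RamState}

theorem runs_forPairs_fixedASpan (hs : Prepared n m Adj σ s) (h5 : ∀ b < m, s.arr 5 b = 0)
    (h8 : ∀ b < m, s.arr 8 b = 0) (h6 : ∀ i < n, s.arr 6 i = (m + 2) * level m i)
    (h9 : s.reg 9 = 1) :
    Runs (forPairs fixedASpan) s (m * (n * (13 + 2) + 4) + 2) fun s' =>
      Prepared n m Adj σ s' ∧ s'.reg 9 = 1 ∧ ∃ F v, HasLabels n m F v (level m) s' ∧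
        ∀ b < m, IsSpan m Adj b n (F b) (v b) := by
  refine (Runs.forPairs (J := fun k j s' => Prepared n m Adj σ s' ∧ s'.reg 9 = 1 ∧
    ∃ F v, HasLabels n m F v (level m) s' ∧ ∀ b < m,
      IsSpan m Adj b (if b < k then n else if b = k then j else 0) (F b) (v b))
    ?_ ?_ ?_ ?_ ?_).mono ?_
  · rintro k j s' ⟨h, -⟩
    exact ⟨h.reg_zero, h.reg_one, h.reg_two⟩
  · rintro k j s' x y hx ⟨h1, h2, F, v, h3, h4⟩
    exact ⟨h1.setReg (by omega) y, by rw [RamState.reg_setReg, if_neg (by omega), h2],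
      F, v, h3, h4⟩
  · rintro k hk s' ⟨h1, h2, F, v, h3, h4⟩
    refine ⟨h1, h2, F, v, h3, fun b hb => ?_⟩
    convert h4 b hb using 1
    split_ifs <;> first | rfl | omega
  · rintro k hk j hj s' ⟨h1, h2, F, v, h3, h4⟩ h10 h11
    have h5 := h4 k hk
    rw [if_neg (by omega), if_pos rfl] at h5
    refine (runs_fixedASpan h1 h3 hk hj h10 h11 h5).mono ?_
    rintro s'' ⟨⟨h6, f, x, h7, h8⟩, h9, h10, h11⟩
    refine ⟨⟨h6, h11.trans h2, _, _, h8, fun b hb => ?_⟩, h9, h10⟩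
    rcases eq_or_ne b k with rfl | hbk
    · simpa using h7
    · simpa [hbk] using h4 b hb
  · refine ⟨hs, h9, fun _ => 0, fun _ => 0, ⟨by simpa using h8, by simpa using h5, h6⟩, ?_⟩
    intro b hb
    simpa using IsSpan.zero m Adj b
  · rintro s' ⟨h1, h2, F, v, h3, h4⟩
    refine ⟨h1, h2, F, v, h3, fun b hb => ?_⟩
    simpa [hb] using h4 b hb

theorem runs_sweep (hs : Prepared n m Adj σ s) {F v e : ℕ → ℕ} (hl : HasLabels n m F v e s) :
    Runs (.seq (.const 9 0) (forPairs fixedARelax)) s (m * (n * (22 + 2) + 4) + 3) fun s' =>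
      (Prepared n m Adj σ s' ∧ ∃ v' e', HasLabels n m F v' e' s' ∧
        PartialSweep n m Adj F v e m 0 v' e' (s'.reg 9)) ∧ s'.reg 20 = s.reg 20 := by
  have key := Runs.forPairs (p := fixedARelax) (T := 22) (n := n) (m := m) (s := s.setReg 9 0)
    (J := fun k j s' => (Prepared n m Adj σ s' ∧ ∃ v' e', HasLabels n m F v' e' s' ∧
        PartialSweep n m Adj F v e k j v' e' (s'.reg 9)) ∧ s'.reg 20 = s.reg 20) ?_ ?_ ?_ ?_ ?_
  · exact ((Runs.of_loopFree (p := .const 9 0) rfl key).seq).mono_time (by simp only [cost]; omega)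
  · rintro k j s' ⟨⟨h, -⟩, -⟩
    exact ⟨h.reg_zero, h.reg_one, h.reg_two⟩
  · rintro k j s' x y hx ⟨⟨h1, v', e', h2, h3⟩, h4⟩
    refine ⟨⟨h1.setReg (by omega) y, v', e', h2, ?_⟩, ?_⟩
    · rwa [RamState.reg_setReg, if_neg (by omega)]
    · rwa [RamState.reg_setReg, if_neg (by omega)]
  · rintro k hk s' ⟨⟨h1, v', e', h2, h3⟩, h4⟩
    exact ⟨⟨h1, v', e', h2, h3.next_row⟩, h4⟩
  · rintro k hk j hj s' ⟨⟨h1, v', e', h2, h3⟩, h4⟩ h10 h11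
    refine (runs_fixedARelax h1 h2 hk hj h10 h11 h3).mono ?_
    rintro s'' ⟨h5, h6, h7, h8⟩
    exact ⟨⟨h5, h8.trans h4⟩, h6, h7⟩
  · exact ⟨⟨hs.setReg (by omega) 0, v, e, hl, by simpa using PartialSweep.refl v e⟩, by simp⟩

/-- The invariant after `r` rounds: the labels lie below every stable labelling above the start, and
they are stable or their sum is at least `r`. Once stable, later rounds are skipped at constant
cost. -/
theorem runs_forLoop_fixedARound (hs : Prepared n m Adj σ s) {F v₀ e₀ : ℕ → ℕ}
    (hl : HasLabels n m F v₀ e₀ s) (h9 : s.reg 9 = 1) :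
    Runs (forLoop 20 6 fixedARound) s
      ((n + m + 1) * ((n + 1) * (m + 1)) * (m * (n * (22 + 2) + 4) + 6) + 2) fun s' =>
      Prepared n m Adj σ s' ∧ ∃ v e, HasLabels n m F v e s' ∧ (∀ b < m, v₀ b ≤ v b) ∧
        (∀ i < n, e₀ i ≤ e i) ∧ ((s'.reg 9 = 0 ∧ Stable n m Adj F v e) ∨
          (s'.reg 9 = 1 ∧ ¬ ∃ w E, Stable n m Adj F w E ∧ (∀ b < m, v₀ b ≤ w b) ∧
            (∀ i < n, e₀ i ≤ E i) ∧ (∀ b < m, w b ≤ (n + 1) * (m + 1)) ∧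
            ∀ i < n, E i ≤ (n + 1) * (m + 1))) := by
  refine (Runs.forLoop (N := (n + m + 1) * ((n + 1) * (m + 1)))
    (T := m * (n * (22 + 2) + 4) + 4)
    (I := fun r s' => s'.reg 20 = r ∧ Prepared n m Adj σ s' ∧ ∃ v e, HasLabels n m F v e s' ∧
      (∀ b < m, v₀ b ≤ v b) ∧ (∀ i < n, e₀ i ≤ e i) ∧
      (∀ w E : ℕ → ℕ, Stable n m Adj F w E → (∀ b < m, v₀ b ≤ w b) → (∀ i < n, e₀ i ≤ E i) →
        (∀ b < m, v b ≤ w b) ∧ ∀ i < n, e i ≤ E i) ∧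
      ((s'.reg 9 = 0 ∧ Stable n m Adj F v e) ∨ (s'.reg 9 = 1 ∧
        r ≤ ∑ b ∈ Finset.range m, v b + ∑ i ∈ Finset.range n, e i))) ?_ ?_ ?_).mono ?_
  · exact ⟨by simp, hs.setReg (by omega) 0, v₀, e₀, hl, fun _ _ => le_rfl, fun _ _ => le_rfl,
      fun _ _ _ h1 h2 => ⟨h1, h2⟩, Or.inr ⟨by simpa using h9, Nat.zero_le _⟩⟩
  · rintro r s' ⟨h1, h2, -⟩
    exact ⟨h1, h2.reg_six⟩
  · rintro r hr s' ⟨h20, h1, v, e, h2, h3, h4, h5, h6⟩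
    have hone := h1.reg_two
    rcases h6 with ⟨h6, h7⟩ | ⟨h6, h7⟩
    · refine (Runs.ite (T := 1) (fun h => ?_) fun _ => ?_).mono_time (by omega)
      · simp [RamTest.holds, h6, hone] at h
      · exact Runs.of_loopFree (p := .skip) rfl ⟨by simp [eval, h20, hone],
          h1.setReg (by omega) _, v, e, h2, h3, h4, h5, Or.inl ⟨by simpa [eval] using h6, h7⟩⟩
    · refine Runs.ite (fun _ => ?_) fun h => ?_
      · refine (runs_sweep h1 h2).mono ?_
        rintro s'' ⟨⟨h8, v', e', h9, h10⟩, h11⟩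
        refine ⟨by simp [h11, h20, h8.reg_two], h8.setReg (by omega) _, v', e', h9,
          fun b hb => (h3 b hb).trans (h10.le_v b hb), fun i hi => (h4 i hi).trans (h10.le_e i hi),
          fun w E hst hw hE => ?_, ?_⟩
        · obtain ⟨h12, h13⟩ := h5 w E hst hw hE
          exact h10.le_of_stable w E hst h12 h13
        · have h12 := h10.flag_le
          rcases Nat.le_one_iff_eq_zero_or_eq_one.1 h12 with h13 | h13
          · exact Or.inl ⟨by simpa using h13, fun b hb i hi => h10.stable h13 b hb i hi (Or.inl hb)⟩
          · refine Or.inr ⟨by simpa using h13, ?_⟩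
            have h14 := h10.sum_le
            omega
      · simp [RamTest.holds, h6, hone] at h
  · rintro s' ⟨-, h1, v, e, h2, h3, h4, h5, h6⟩
    refine ⟨h1, v, e, h2, h3, h4, h6.imp_right ?_⟩
    rintro ⟨h7, h8⟩
    refine ⟨h7, ?_⟩
    rintro ⟨w, E, hst, hw, hE, hwb, hEb⟩
    obtain ⟨h9, h10⟩ := h5 w E hst hw hE
    have h11 : ∑ b ∈ Finset.range m, v b ≤ m * ((n + 1) * (m + 1)) := by
      simpa using Finset.sum_le_card_nsmul (Finset.range m) v ((n + 1) * (m + 1)) fun b hb =>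
        (h9 b (Finset.mem_range.1 hb)).trans (hwb b (Finset.mem_range.1 hb))
    have h12 : ∑ i ∈ Finset.range n, e i ≤ n * ((n + 1) * (m + 1)) := by
      simpa using Finset.sum_le_card_nsmul (Finset.range n) e ((n + 1) * (m + 1)) fun i hi =>
        (h10 i (Finset.mem_range.1 hi)).trans (hEb i (Finset.mem_range.1 hi))
    -- The number of rounds exceeds the largest possible sum by `(n + 1) * (m + 1)`, a
    -- contradiction.
    have h13 : 0 < (n + 1) * (m + 1) := by positivity
    rw [Nat.succ_mul, Nat.add_mul] at h8
    omega

/-- Running sums replace products: registers `7` and `8` step by `(m + 1) * (m + 2)` and `m`. The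
ordering is copied to array `9` because the output will overwrite array `1`. -/
theorem runs_forLoop_fixedALevel (h0 : s.reg 0 = n) (h1 : s.reg 1 = m) (h2 : s.reg 2 = 1)
    (h3 : s.reg 3 = 0) (h4 : s.reg 4 = m + 2) (h5 : s.reg 5 = (m + 1) * (m + 2))
    (h6 : s.reg 6 = (n + m + 1) * ((n + 1) * (m + 1))) (h7 : s.reg 7 = 0) (h8 : s.reg 8 = 0)
    (h9 : s.reg 9 = 1) (hσ : ∀ i < n, s.arr 1 i < n)
    (hadj : ∀ i < n, ∀ b < m, Adj i b → s.arr 0 (s.arr 1 i * m + b) = 1)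
    (hnadj : ∀ i < n, ∀ b < m, ¬ Adj i b → s.arr 0 (s.arr 1 i * m + b) = 0) :
    Runs (forLoop 11 0 fixedALevel) s (n * 9 + 2) fun s' =>
      Prepared n m Adj (s.arr 1) s' ∧ s'.reg 9 = 1 ∧ (∀ b, s'.arr 5 b = s.arr 5 b) ∧
        (∀ b, s'.arr 8 b = s.arr 8 b) ∧ ∀ i < n, s'.arr 6 i = (m + 2) * level m i := by
  refine (Runs.forLoop (N := n) (T := 7)
    (I := fun k s' => s'.reg 11 = k ∧ (∀ x < 7, s'.reg x = s.reg x) ∧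
      s'.reg 7 = k * ((m + 1) * (m + 2)) ∧ s'.reg 8 = k * m ∧ s'.reg 9 = 1 ∧
      (∀ l, l = 0 ∨ l = 1 ∨ l = 5 ∨ l = 8 → ∀ j, s'.arr l j = s.arr l j) ∧
      ∀ i < k, s'.arr 9 i = s.arr 1 i ∧ s'.arr 7 i = (m + 2) * level m i ∧
        s'.arr 6 i = (m + 2) * level m i ∧ s'.arr 4 i = i * m) ?_ ?_ ?_).mono ?_
  · refine ⟨by simp, fun x hx => ?_, by simp [h7], by simp [h8], by simp [h9], by simp, by simp⟩
    rw [RamState.reg_setReg, if_neg (by omega)]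
  · rintro k s' ⟨h10, h11, -⟩
    exact ⟨h10, by rw [h11 0 (by omega), h0]⟩
  · rintro k hk s' ⟨h11, hr, hr7, hr8, hr9, hout, hin⟩
    refine Runs.of_loopFree (p := fixedALevel) rfl ?_
    have hr2 : s'.reg 2 = 1 := by rw [hr 2 (by omega), h2]
    have hr5 : s'.reg 5 = (m + 1) * (m + 2) := by rw [hr 5 (by omega), h5]
    have hr1 : s'.reg 1 = m := by rw [hr 1 (by omega), h1]
    refine ⟨?_, fun x hx => ?_, ?_, ?_, ?_, ?_, ?_⟩
    · simp [fixedALevel, eval, h11, hr2]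
    · have hx7 : x ≠ 7 := by omega
      have hx8 : x ≠ 8 := by omega
      have hx11 : x ≠ 11 := by omega
      have hx12 : x ≠ 12 := by omega
      simp [fixedALevel, eval, hx7, hx8, hx11, hx12, hr x hx]
    · simp [fixedALevel, eval, hr7, hr5]
      ring
    · simp [fixedALevel, eval, hr8, hr1]
      ring
    · simp [fixedALevel, eval, hr9]
    · intro l hl j
      have hl4 : l ≠ 4 := by omega
      have hl6 : l ≠ 6 := by omega
      have hl7 : l ≠ 7 := by omega
      have hl9 : l ≠ 9 := by omega
      simp [fixedALevel, eval, hl4, hl6, hl7, hl9, hout l hl]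
    · intro i hi
      rcases Nat.lt_succ_iff_lt_or_eq.1 hi with hik | rfl
      · have hne : i ≠ k := by omega
        simpa [fixedALevel, eval, h11, hne] using hin i hik
      · have h12 : i * ((m + 1) * (m + 2)) + (m + 1) * (m + 2) = (m + 2) * level m i := by
          rw [level]
          ring
        simp [fixedALevel, eval, h11, hout, hr7, hr8, hr5, h12]
  · rintro s' ⟨-, hr, hr7, hr8, hr9, hout, hin⟩
    -- Row offsets are indexed by vertices, not positions; `hσ` ensures that the offset read at `σ
    -- i` has been filled in.
    have hentry : ∀ i < n, ∀ b, s'.arr 0 (s'.arr 4 (s'.arr 9 i) + b) =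
        s.arr 0 (s.arr 1 i * m + b) := fun i hi b => by
      rw [(hin i hi).1, (hin _ (hσ i hi)).2.2.2, hout 0 (by omega)]
    refine ⟨⟨?_, ?_, ?_, ?_, ?_, ?_, hr7, fun i hi b hb h => ?_, fun i hi b hb h => ?_,
      fun i hi => (hin i hi).1, fun i hi => (hin i hi).2.1⟩, hr9, hout 5 (by omega),
      hout 8 (by omega), fun i hi => (hin i hi).2.2.1⟩
    · rw [hr 0 (by omega), h0]
    · rw [hr 1 (by omega), h1]
    · rw [hr 2 (by omega), h2]
    · rw [hr 3 (by omega), h3]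
    · rw [hr 4 (by omega), h4]
    · rw [hr 6 (by omega), h6]
    · rw [hentry i hi, hadj i hi b hb h]
    · rw [hentry i hi, hnadj i hi b hb h]

/-- Register `7` still holds the scaled last level `n * ((m + 1) * (m + 2))` (zero if `n = 0`),
which serves as the ground constant. Registers `0` and `1` bound the loops and are overwritten only
at the end. -/
theorem runs_fixedAOutput (hs : Prepared n m Adj σ s) {F v e : ℕ → ℕ}
    (hl : HasLabels n m F v e s) (h9 : s.reg 9 = 0)
    (hσ : ∀ i < n, ∀ j < n, σ i = σ j → i = j) :
    Runs fixedAOutput s (n * 10 + m * 9 + 7) fun s' =>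
      s'.reg 0 = 1 ∧ s'.reg 1 = n * ((m + 1) * (m + 2)) ∧
      (∀ i < n, s'.arr 0 (σ i) = (m + 2) * level m i + m + 1 ∧
        s'.arr 1 (σ i) = (m + 2) * e i + m + 2) ∧
      ∀ b < m, s'.arr 2 b = (m + 2) * v b + b + 1 ∧
        s'.arr 3 b = n * ((m + 1) * (m + 2)) - (m + 2) * F b := by
  obtain ⟨hF, hv, he⟩ := hl
  refine (Runs.ite (T := n * 10 + m * 9 + 6) (fun _ => ?_) fun h => ?_).mono_time le_rfl
  swap
  · simp [RamTest.holds, h9, hs.reg_three] at h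
  refine (Runs.seq (T := n * (8 + 2) + 2) (T' := m * (7 + 2) + 4) ?_).mono_time (by omega)
  refine (Runs.forLoop (N := n) (T := 8)
    (I := fun k s' => s'.reg 11 = k ∧ (∀ x < 9, s'.reg x = s.reg x) ∧
      (∀ l, 2 ≤ l → ∀ j, s'.arr l j = s.arr l j) ∧
      ∀ i < k, s'.arr 0 (σ i) = (m + 2) * level m i + m + 1 ∧
        s'.arr 1 (σ i) = (m + 2) * e i + m + 2) ?_ ?_ ?_).mono ?_
  · refine ⟨by simp, fun x hx => ?_, by simp, by simp⟩
    rw [RamState.reg_setReg, if_neg (by omega)]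
  · rintro k s' ⟨h10, h11, -⟩
    exact ⟨h10, by rw [h11 0 (by omega), hs.reg_zero]⟩
  · rintro k hk s' ⟨h11, hr, hout, hin⟩
    refine Runs.of_loopFree (p := fixedAWriteH) rfl ?_
    have hr2 : s'.reg 2 = 1 := by rw [hr 2 (by omega), hs.reg_two]
    have hr4 : s'.reg 4 = m + 2 := by rw [hr 4 (by omega), hs.reg_four]
    refine ⟨?_, fun x hx => ?_, ?_, ?_⟩
    · simp [fixedAWriteH, eval, h11, hr2]
    · have hx11 : x ≠ 11 := by omega
      have hx12 : x ≠ 12 := by omega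
      have hx13 : x ≠ 13 := by omega
      simp [fixedAWriteH, eval, hx11, hx12, hx13, hr x hx]
    · intro l hl j
      have hl0 : l ≠ 0 := by omega
      have hl1 : l ≠ 1 := by omega
      simp [fixedAWriteH, eval, hl0, hl1, hout l hl]
    · intro i hi
      rcases Nat.lt_succ_iff_lt_or_eq.1 hi with hik | rfl
      · have hne : σ i ≠ σ k := fun h => by
          have := hσ i (by omega) k hk h
          omega
        simpa [fixedAWriteH, eval, h11, hout, hs.perm k hk, hne] using hin i hik
      · simp [fixedAWriteH, eval, h11, hout, hs.perm i hk, hr4, hr2, hs.levels i hk, he i hk]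
        omega
  · rintro s₁ ⟨-, hr₁, hout₁, hin₁⟩
    refine Runs.seq (T := m * (7 + 2) + 2) (T' := 2) ?_
    refine (Runs.forLoop (N := m) (T := 7)
      (I := fun k s' => s'.reg 10 = k ∧ (∀ x < 9, s'.reg x = s.reg x) ∧
        (∀ l, 4 ≤ l → ∀ j, s'.arr l j = s.arr l j) ∧
        (∀ l, l ≤ 1 → ∀ j, s'.arr l j = s₁.arr l j) ∧
        ∀ b < k, s'.arr 2 b = (m + 2) * v b + b + 1 ∧
          s'.arr 3 b = n * ((m + 1) * (m + 2)) - (m + 2) * F b) ?_ ?_ ?_).mono ?_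
    · refine ⟨by simp, fun x hx => ?_, ?_, by simp, by simp⟩
      · rw [RamState.reg_setReg, if_neg (by omega), hr₁ x hx]
      · exact fun l hl => hout₁ l (by omega)
    · rintro k s' ⟨h10, h11, -⟩
      exact ⟨h10, by rw [h11 1 (by omega), hs.reg_one]⟩
    · rintro k hk s' ⟨h10, hr, hout, hout', hin⟩
      refine Runs.of_loopFree (p := fixedAWriteV) rfl ?_
      have hr2 : s'.reg 2 = 1 := by rw [hr 2 (by omega), hs.reg_two]
      have hr7 : s'.reg 7 = n * ((m + 1) * (m + 2)) := by rw [hr 7 (by omega), hs.reg_seven]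
      refine ⟨?_, fun x hx => ?_, ?_, ?_, ?_⟩
      · simp [fixedAWriteV, eval, h10, hr2]
      · have hx10 : x ≠ 10 := by omega
        have hx12 : x ≠ 12 := by omega
        simp [fixedAWriteV, eval, hx10, hx12, hr x hx]
      · intro l hl j
        have hl2 : l ≠ 2 := by omega
        have hl3 : l ≠ 3 := by omega
        simp [fixedAWriteV, eval, hl2, hl3, hout l hl]
      · intro l hl j
        have hl2 : l ≠ 2 := by omega
        have hl3 : l ≠ 3 := by omega
        simp [fixedAWriteV, eval, hl2, hl3, hout' l hl]
      · intro b hb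
        rcases Nat.lt_succ_iff_lt_or_eq.1 hb with hbk | rfl
        · have hne : b ≠ k := by omega
          simpa [fixedAWriteV, eval, h10, hne] using hin b hbk
        · simp [fixedAWriteV, eval, h10, hout, hr2, hr7, hF b hk, hv b hk]
    · rintro s₂ ⟨-, hr, -, hout', hin⟩
      refine Runs.of_loopFree (p := .seq (.copy 1 7) (.const 0 1)) rfl ⟨?_, ?_, ?_, ?_⟩
      · simp [eval]
      · simp [eval, hr 7, hs.reg_seven]
      · intro i hi
        simpa [eval, hout'] using hin₁ i hi
      · intro b hb
        simpa [eval] using hin b hb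

end

/-! ### The theorem -/

theorem fixedAInput_entry_of_adj {n m : ℕ} {G : SimpleGraph (Fin n ⊕ Fin m)}
    {σ : Equiv.Perm (Fin n)} {i b : ℕ} (h : orderedAdj G σ i b) :
    (fixedAInput G σ).arr 0 ((fixedAInput G σ).arr 1 i * m + b) = 1 := by
  obtain ⟨hi, hb, h⟩ := h
  simp only [fixedAInput, one_ne_zero, if_false, if_true, dif_pos hi]
  exact if_pos ⟨_, _, rfl, h⟩

/-- Division with remainder by `m` shows that a cell determines its row and column, so no other edge
can put a `1` there. -/
theorem fixedAInput_entry_of_not_adj {n m : ℕ} {G : SimpleGraph (Fin n ⊕ Fin m)}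
    {σ : Equiv.Perm (Fin n)} {i b : ℕ} (hi : i < n) (hb : b < m) (h : ¬ orderedAdj G σ i b) :
    (fixedAInput G σ).arr 0 ((fixedAInput G σ).arr 1 i * m + b) = 0 := by
  simp only [fixedAInput, one_ne_zero, if_false, if_true, dif_pos hi]
  refine if_neg ?_
  rintro ⟨a, c, hac, hG⟩
  have hm : 0 < m := by omega
  have h1 := congrArg (· % m) hac
  have h2 := congrArg (· / m) hac
  simp only [mul_comm _ m, Nat.mul_add_mod, Nat.mul_add_div hm, Nat.mod_eq_of_lt hb,
    Nat.mod_eq_of_lt c.2, Nat.div_eq_of_lt hb, Nat.div_eq_of_lt c.2, add_zero] at h1 h2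
  obtain rfl : σ ⟨i, hi⟩ = a := Fin.ext h2
  obtain rfl : (⟨b, hb⟩ : Fin m) = c := Fin.ext h1
  exact h ⟨hi, hb, hG⟩

/-- A bound for the running time of `fixedAStick`. -/
def fixedATime (n m : ℕ) : ℕ :=
  (n + m + 1) * ((n + 1) * (m + 1)) * (m * (n * 24 + 4) + 6) + m * (n * 15 + 4) +
    25 * (n + m + 1) + 20

theorem runs_fixedAStick {n m : ℕ} {G : SimpleGraph (Fin n ⊕ Fin m)}
    (hG : G.IsBipartiteWith (Set.range Sum.inl) (Set.range Sum.inr)) (σ : Equiv.Perm (Fin n)) :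
    Runs fixedAStick (fixedAInput G σ) (fixedATime n m) fun s =>
      (s.reg 0 = 1 ∧ (s.drawing n m).Represents G ∧ (s.drawing n m).RespectsA σ) ∨
      (s.reg 0 = 0 ∧ ¬ ∃ D : StickDrawing (Fin n) (Fin m), D.Represents G ∧ D.RespectsA σ) := by
  have hσ (i : ℕ) (hi : i < n) : (fixedAInput G σ).arr 1 i = σ ⟨i, hi⟩ := by
    simp [fixedAInput, hi]
  have hin0 : (fixedAInput G σ).reg 0 = n := by simp [fixedAInput]
  have hin1 : (fixedAInput G σ).reg 1 = m := by simp [fixedAInput]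
  have hreg : ∀ x, 1 < x → (fixedAInput G σ).reg x = 0 := fun x hx => by
    simp only [fixedAInput]
    rw [if_neg (by omega), if_neg (by omega)]
  have harr : ∀ k, 1 < k → ∀ i, (fixedAInput G σ).arr k i = 0 := fun k hk i => by
    simp only [fixedAInput]
    rw [if_neg (by omega), if_neg (by omega)]
  refine (Runs.seq (T := 6) (T' := fixedATime n m - 6) ?_).mono_time
    (by unfold fixedATime; omega)
  refine Runs.of_loopFree (p := fixedAPrepare) rfl ?_
  obtain ⟨s₀, hs₀⟩ : ∃ s, s = eval fixedAPrepare (fixedAInput G σ) := ⟨_, rfl⟩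
  rw [← hs₀]
  have h₀arr : s₀.arr = (fixedAInput G σ).arr := by simp [hs₀, fixedAPrepare, eval]
  have h₀0 : s₀.reg 0 = n := by simp [hs₀, fixedAPrepare, eval, hin0]
  have h₀1 : s₀.reg 1 = m := by simp [hs₀, fixedAPrepare, eval, hin1]
  have h₀2 : s₀.reg 2 = 1 := by simp [hs₀, fixedAPrepare, eval]
  have h₀3 : s₀.reg 3 = 0 := by simp [hs₀, fixedAPrepare, eval, hreg]
  have h₀4 : s₀.reg 4 = m + 2 := by simp [hs₀, fixedAPrepare, eval, hin1]
  have h₀7 : s₀.reg 7 = 0 := by simp [hs₀, fixedAPrepare, eval, hreg]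
  have h₀8 : s₀.reg 8 = 0 := by simp [hs₀, fixedAPrepare, eval, hreg]
  have h₀9 : s₀.reg 9 = 1 := by simp [hs₀, fixedAPrepare, eval]
  have h₀12 : s₀.reg 12 = m + 1 := by simp [hs₀, fixedAPrepare, eval, hin1]
  have h₀13 : s₀.reg 13 = n + 1 := by simp [hs₀, fixedAPrepare, eval, hin0]
  have h₀14 : s₀.reg 14 = n + m + 1 := by
    simp [hs₀, fixedAPrepare, eval, hin0, hin1, add_assoc]
  clear hs₀
  have htime : (m + 1) * 3 + 3 + ((n + 1) * 3 + 3 + ((n + m + 1) * 3 + 3 + (n * 9 + 2 +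
      (m * (n * (13 + 2) + 4) + 2 + ((n + m + 1) * ((n + 1) * (m + 1)) *
      (m * (n * (22 + 2) + 4) + 6) + 2 + (n * 10 + m * 9 + 7)))))) ≤ fixedATime n m - 6 := by
    have : 13 + 2 = 15 ∧ 22 + 2 = 24 := by omega
    unfold fixedATime
    rw [this.1, this.2]
    omega
  refine Runs.mono_time ?_ htime
  refine ((Runs.mul h₀12 h₀4 h₀2 (by simp) (by simp)).mono ?_).seq
  rintro s₁ ⟨h₁, h₁arr, h₁5⟩
  refine ((Runs.mul ((h₁ 13 (by simp) (by simp)).trans h₀13)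
    ((h₁ 12 (by simp) (by simp)).trans h₀12) ((h₁ 2 (by simp) (by simp)).trans h₀2)
    (by simp) (by simp)).mono ?_).seq
  rintro s₂ ⟨h₂, h₂arr, h₂15⟩
  refine ((Runs.mul (((h₂ 14 (by simp) (by simp)).trans (h₁ 14 (by simp) (by simp))).trans h₀14)
    h₂15 (((h₂ 2 (by simp) (by simp)).trans (h₁ 2 (by simp) (by simp))).trans h₀2)
    (by simp) (by simp)).mono ?_).seq
  rintro s₃ ⟨h₃, h₃arr, h₃6⟩
  have h₃' : ∀ x, x ≠ 5 → x ≠ 6 → x ≠ 15 → x ≠ 20 → s₃.reg x = s₀.reg x :=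
    fun x h5 h6 h15 h20 => by rw [h₃ x h6 h20, h₂ x h15 h20, h₁ x h5 h20]
  have h₃arr' : s₃.arr = (fixedAInput G σ).arr := by rw [h₃arr, h₂arr, h₁arr, h₀arr]
  refine ((runs_forLoop_fixedALevel (n := n) (m := m) (Adj := orderedAdj G σ)
    (by rw [h₃' 0 (by simp) (by simp) (by simp) (by simp), h₀0])
    (by rw [h₃' 1 (by simp) (by simp) (by simp) (by simp), h₀1])
    (by rw [h₃' 2 (by simp) (by simp) (by simp) (by simp), h₀2])
    (by rw [h₃' 3 (by simp) (by simp) (by simp) (by simp), h₀3])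
    (by rw [h₃' 4 (by simp) (by simp) (by simp) (by simp), h₀4])
    (by rw [h₃ 5 (by simp) (by simp), h₂ 5 (by simp) (by simp), h₁5]) h₃6
    (by rw [h₃' 7 (by simp) (by simp) (by simp) (by simp), h₀7])
    (by rw [h₃' 8 (by simp) (by simp) (by simp) (by simp), h₀8])
    (by rw [h₃' 9 (by simp) (by simp) (by simp) (by simp), h₀9])
    (fun i hi => by rw [h₃arr', hσ i hi]; exact Fin.is_lt _)
    (fun i hi b hb h => by rw [h₃arr']; exact fixedAInput_entry_of_adj h)
    (fun i hi b hb h => by rw [h₃arr']; exact fixedAInput_entry_of_not_adj hi hb h)).mono ?_).seq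
  rintro s₄ ⟨h₄, h₄9, h₄5, h₄8, h₄6⟩
  refine ((runs_forPairs_fixedASpan h₄ (fun b _ => by rw [h₄5, h₃arr', harr 5 (by omega)])
    (fun b _ => by rw [h₄8, h₃arr', harr 8 (by omega)]) h₄6 h₄9).mono ?_).seq
  rintro s₅ ⟨h₅, h₅9, F, v₀, hl₅, hspan⟩
  refine ((runs_forLoop_fixedARound h₅ hl₅ h₅9).mono ?_).seq
  rintro s₆ ⟨h₆, v, e, hl₆, hv, he, ⟨hflag, hst⟩ | ⟨hflag, hno⟩⟩
  · refine (runs_fixedAOutput h₆ hl₆ hflag fun i hi j hj hij => ?_).mono ?_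
    · rw [h₃arr', hσ i hi, hσ j hj] at hij
      exact congrArg Fin.val (σ.injective (Fin.ext hij))
    · rintro s ⟨h0, h1, hA, hB⟩
      refine Or.inl ⟨h0, represents_of_stable hG hspan hv he hst
        (g := n * ((m + 1) * (m + 2))) (fun b hb => ?_) ?_ (fun i => ?_) (fun i => ?_)
        (fun b => ?_) fun b => ?_⟩
      -- No first-neighbour level exceeds the last level, so the subtraction giving the top of `b`
      -- is not truncated.
      · rcases (hspan b hb).2 with ⟨h2, -⟩ | ⟨⟨i, hi, -, h2⟩, -⟩
        · simp [h2]
        · rw [h2, level]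
          calc (m + 2) * ((i + 1) * (m + 1)) = (i + 1) * ((m + 1) * (m + 2)) := by ring
            _ ≤ n * ((m + 1) * (m + 2)) := Nat.mul_le_mul_right _ hi
      · simp only [RamState.drawing, h1]
      · have h2 := (hA i i.2).1
        rw [h₃arr', hσ i i.2] at h2
        exact congrArg (Nat.cast : ℕ → ℝ) h2
      · have h2 := (hA i i.2).2
        rw [h₃arr', hσ i i.2] at h2
        exact congrArg (Nat.cast : ℕ → ℝ) h2
      · exact congrArg (Nat.cast : ℕ → ℝ) (hB b b.2).1
      · exact congrArg (Nat.cast : ℕ → ℝ) (hB b b.2).2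
  · have hne : ¬ RamTest.holds (.eq 9 3) s₆ := by simp [RamTest.holds, hflag, h₆.reg_three]
    refine (Runs.ite (T := 1) (fun h => absurd h hne) fun _ =>
      Runs.of_loopFree (p := .const 0 0) rfl (Or.inr ⟨by simp [eval], ?_⟩)).mono_time (by omega)
    rintro ⟨D, hD, hDσ⟩
    obtain ⟨w, E, hwE, hw, hE, hwb, hEb⟩ := exists_stable_of_represents hspan hD hDσ
    exact hno ⟨w, E, hwE, hw, hE, hwb, hEb⟩

/-- For positive `n` and `m` every factor is at most a multiple of `n * m`; the constant is `3 * 4 *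
34` for the rounds plus `114` for the rest. -/
theorem fixedATime_le {n m : ℕ} (hn : 0 < n) (hm : 0 < m) :
    fixedATime n m ≤ 522 * (n ^ 3 * m ^ 3) := by
  have hnm : 0 < n * m := Nat.mul_pos hn hm
  have h1 : n ≤ n * m := Nat.le_mul_of_pos_right n hm
  have h2 : m ≤ n * m := Nat.le_mul_of_pos_left m hn
  have h3 : (n + 1) * (m + 1) ≤ 4 * (n * m) := by
    rw [Nat.add_mul, Nat.mul_succ]
    omega
  have h4 : n + m + 1 ≤ 3 * (n * m) := by omega
  have h5 : m * (n * 24 + 4) + 6 ≤ 34 * (n * m) := by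
    have : m * (n * 24 + 4) = 24 * (n * m) + 4 * m := by ring
    omega
  have h6 : m * (n * 15 + 4) + 25 * (n + m + 1) + 20 ≤ 114 * (n * m) := by
    have : m * (n * 15 + 4) = 15 * (n * m) + 4 * m := by ring
    omega
  have h7 : (n + m + 1) * ((n + 1) * (m + 1)) * (m * (n * 24 + 4) + 6) ≤
      3 * (n * m) * (4 * (n * m)) * (34 * (n * m)) :=
    Nat.mul_le_mul (Nat.mul_le_mul h4 h3) h5
  have h8 : n * m ≤ (n * m) ^ 3 := Nat.le_self_pow (by omega) _
  have h9 : 3 * (n * m) * (4 * (n * m)) * (34 * (n * m)) = 408 * (n * m) ^ 3 := by ring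
  rw [← mul_pow]
  unfold fixedATime
  omega

theorem theorem4 :
    ∃ (P : RamProgram) (C : ℕ),
      ∀ (n m : ℕ) (G : SimpleGraph (Fin n ⊕ Fin m)),
        G.IsBipartiteWith (Set.range Sum.inl) (Set.range Sum.inr) →
        ∀ σ : Equiv.Perm (Fin n),
          ∃ (t : ℕ) (s : RamState), RamExec P (fixedAInput G σ) t s ∧
            (0 < n → 0 < m → t ≤ C * (n ^ 3 * m ^ 3)) ∧
            ((∃ D : StickDrawing (Fin n) (Fin m), D.Represents G ∧ D.RespectsA σ) →
              s.reg 0 = 1 ∧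
                (s.drawing n m).Represents G ∧ (s.drawing n m).RespectsA σ) ∧
            ((¬ ∃ D : StickDrawing (Fin n) (Fin m), D.Represents G ∧ D.RespectsA σ) →
              s.reg 0 = 0) := by
  refine ⟨fixedAStick, 522, fun n m G hG σ => ?_⟩
  obtain ⟨t, s, hexec, ht, h⟩ := runs_fixedAStick hG σ
  refine ⟨t, s, hexec, fun hn hm => ht.trans (fixedATime_le hn hm), fun hD => ?_, fun hD => ?_⟩
  · exact h.resolve_right fun h' => h'.2 hD
  · rcases h with h | h
    · exact absurd ⟨_, h.2⟩ hD
    · exact h.1
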